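/- Let $a,b,c$ be positive integers. Project $\mathbb{R}^3$ to the plane along $(1,1,1)$, so that the coordinate directions $x,y,z$ point to the lower left, to the lower right and upwards, and let $H$ be the image of the box $[0,b]\times[0,a]\times[0,c]$, a hexagon with sides $a,b,c,a,b,c$ in the triangular lattice. A lozenge tiling of $H$ is a tiling of $H$ by lozenges (unions of two adjacent unit lattice triangles); the lozenges are of three types, called left, right and top tiles, the projections of unit squares orthogonal to the $x$-, $y$- and $z$-axis, respectively. Every lozenge tiling is the picture of a unique boxed plane partition, i.e. of a pile of unit cubes in the box, stacked against the floor and the two back walls. A left corner of a tiling consists of a top tile and a left tile that meet along an edge like the top and the left face of a cube, and its height in $\{1,\dots,c\}$ is the $z$-coordinate of its top tile in the pile of cubes. For a uniformly random lozenge tiling of $H$, let $\Gamma_\ell$ be the number of left corners of height $\ell$. For the rectangular partition $\rho=(a^b)$ ($b$ rows of length $a$) let $s_\rho$ be the Schur polynomial, and let $S_\rho(x_1,\dots,x_k;N)=s_\rho(x_1,\dots,x_k,1^{N-k})/s_\rho(1^N)$ be the normalized Schur polynomial. Then, for all $x_1,\dots,x_c\in\mathbb{C}$, $$\sum_{\gamma\in\mathbb{N}^c}\mathrm{P}(\Gamma_1=\gamma_1,\dots,\Gamma_c=\gamma_c)\,x_1^{\gamma_1}\cdots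 x_c^{\gamma_c}=S_\rho(x_1,\dots,x_c;b+c)=\frac{s_{(a^b)}(1^b,x_1,\dots,x_c)}{s_{(a^b)}(1^{b+c})}.$$ -/

import Mathlib

/-! ### The triangular lattice, lozenges, and the hexagon

The plane is `ℝ³` projected along `(1, 1, 1)`: the unit vectors `e_x, e_y, e_z` become plane vectors
with directions `210°, -30°, 90°` and `e_x + e_y + e_z = 0`. The lattice point `u e_x + v e_y` is
encoded as `(u, v) : ℤ × ℤ`, so that `e_z = (-1, -1)`. -/

/-- The projection of the point `(x, y, z)` of `ℤ³` to the triangular lattice. -/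
def proj (x y z : ℤ) : ℤ × ℤ := (x - z, y - z)

/-- The two kinds of unit triangles of the lattice (both have a vertical side). -/
inductive TriangleKind
  | pointsLeft
  | pointsRight

/-- A unit triangle of the triangular lattice, given by its kind and its uppermost vertex. -/
structure Triangle where
  kind : TriangleKind
  pos : ℤ × ℤ

/-- The vertices of a unit triangle: `p, p + e_x, p + e_x + e_y` or `p, p + e_y, p + e_x + e_y`. -/
def Triangle.vertices : Triangle → Set (ℤ × ℤ)
  | ⟨.pointsLeft, p⟩ => {p, p + (1, 0), p + (1, 1)}
  | ⟨.pointsRight, p⟩ => {p, p + (0, 1), p + (1, 1)}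

/-- The three types of lozenges. -/
inductive LozengeKind
  | left
  | top
  | right

/-- A lozenge. A top, left or right lozenge is the projection of a unit square of `ℝ³` orthogonal
to `e_z`, `e_x` or `e_y`; `pos` is the projection of the vertex of the square whose coordinates are
all maximal. Thus the lozenge has the vertices `pos`, `pos - e`, `pos - f`, `pos - e - f` with
`{e, f}` equal to `{e_x, e_y}`, `{e_y, e_z}`, `{e_x, e_z}`, respectively. -/
structure Lozenge where
  kind : LozengeKind
  pos : ℤ × ℤ

/-- The two adjacent unit triangles that make up a lozenge. -/
def Lozenge.triangles : Lozenge → Set Triangle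
  | ⟨.top, q⟩ => {⟨.pointsLeft, q - (1, 1)⟩, ⟨.pointsRight, q - (1, 1)⟩}
  | ⟨.left, q⟩ => {⟨.pointsLeft, q⟩, ⟨.pointsRight, q - (0, 1)⟩}
  | ⟨.right, q⟩ => {⟨.pointsLeft, q - (1, 0)⟩, ⟨.pointsRight, q⟩}

/-- The lattice points of the hexagon with sides `a, b, c, a, b, c`, which is the projection of the
box `[0, b] × [0, a] × [0, c]`. -/
def hexagonPoints (a b c : ℕ) : Set (ℤ × ℤ) :=
  {p | -(c : ℤ) ≤ p.1 ∧ p.1 ≤ b ∧ -(c : ℤ) ≤ p.2 ∧ p.2 ≤ a ∧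
    -(a : ℤ) ≤ p.1 - p.2 ∧ p.1 - p.2 ≤ b}

/-- The unit triangles contained in the hexagon. -/
def hexagon (a b c : ℕ) : Set Triangle :=
  {t | t.vertices ⊆ hexagonPoints a b c}

/-- The set `LT(a, b, c)` of lozenge tilings of the hexagon with sides `a, b, c, a, b, c`. -/
def lozengeTilings (a b c : ℕ) : Set (Finset Lozenge) :=
  {T | (∀ L ∈ T, L.triangles ⊆ hexagon a b c) ∧
    ∀ t ∈ hexagon a b c, ∃! L, L ∈ T ∧ t ∈ L.triangles}

/-- All events are measurable. -/
instance : MeasurableSpace (Finset Lozenge) := ⊤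

/-! ### Piles of cubes, left corners and their heights -/

/-- Plane partitions with at most `b` rows, at most `a` columns and entries at most `c`.
Rows and columns are numbered from `0`. -/
structure BoxedPlanePartition (a b c : ℕ) where
  entry : ℕ → ℕ → ℕ
  row_anti : ∀ i j, entry i (j + 1) ≤ entry i j
  col_anti : ∀ i j, entry (i + 1) j ≤ entry i j
  entry_le : entry 0 0 ≤ c
  rows_le : ∀ i j, b ≤ i → entry i j = 0
  cols_le : ∀ i j, a ≤ j → entry i j = 0

namespace BoxedPlanePartition

variable {a b c : ℕ}

/-- The height of the pile over the unit square `[i - 1, i] × [j - 1, j]` of the `xy`-plane, where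
`entry i j` cubes stand on `[i, i + 1] × [j, j + 1]` and the walls of height `c` behind the pile
are given by `i = 0` and `j = 0`. -/
def height (π : BoxedPlanePartition a b c) : ℕ → ℕ → ℕ
  | 0, _ => c
  | _ + 1, 0 => c
  | i + 1, j + 1 => π.entry i j

/-- The lozenges seen when the pile of cubes of `π`, standing in a box with a floor and two back
walls, is projected along `(1, 1, 1)`. -/
inductive IsVisible (π : BoxedPlanePartition a b c) : Lozenge → Prop
  | top (i j : ℕ) (hi : i < b) (hj : j < a) :
      IsVisible π ⟨.top, proj (i + 1) (j + 1) (π.entry i j)⟩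
  | left (i j k : ℕ) (hi : i ≤ b) (hj : j < a)
      (hk : π.height (i + 1) (j + 1) < k) (hk' : k ≤ π.height i (j + 1)) :
      IsVisible π ⟨.left, proj i (j + 1) k⟩
  | right (i j k : ℕ) (hi : i < b) (hj : j ≤ a)
      (hk : π.height (i + 1) (j + 1) < k) (hk' : k ≤ π.height (i + 1) j) :
      IsVisible π ⟨.right, proj (i + 1) j k⟩

end BoxedPlanePartition

/-- `T` has a left corner at the lattice point `q`: a top tile and a left tile of `T` that together
look like the top and the left face of a cube (the front edge of the top tile on its left side is
the upper edge of the left tile). -/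
def IsLeftCorner (T : Finset Lozenge) (q : ℤ × ℤ) : Prop :=
  ⟨.top, q⟩ ∈ T ∧ ⟨.left, q⟩ ∈ T

/-- When `T` is viewed as the picture of a pile of cubes in the box, the top tile of `T` at `q` is
a top face of the pile with `z`-coordinate `h`. -/
def HasHeight (a b c : ℕ) (T : Finset Lozenge) (q : ℤ × ℤ) (h : ℕ) : Prop :=
  ∃ π : BoxedPlanePartition a b c, (∀ L, L ∈ T ↔ π.IsVisible L) ∧
    ∃ i j : ℕ, i < b ∧ j < a ∧ q = proj (i + 1) (j + 1) (π.entry i j) ∧ π.entry i j = h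

/-- The vector `(Γ_1, …, Γ_c)`, with `Γ_ℓ` the number of left corners of height `ℓ`;
the index `ℓ : Fin c` stands for the height `ℓ + 1`. -/
noncomputable def cornerCount (a b c : ℕ) (T : Finset Lozenge) (ℓ : Fin c) : ℕ :=
  Set.ncard {q | IsLeftCorner T q ∧ HasHeight a b c T q (ℓ + 1)}

/-! ### Schur polynomials -/

/-- Semistandard Young tableaux of shape `μ` with entries in `{0, …, n - 1}`. -/
def BoundedSSYT (μ : YoungDiagram) (n : ℕ) : Type :=
  {T : SemistandardYoungTableau μ // ∀ c ∈ μ.cells, T c.1 c.2 < n}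

/-- The entry of a bounded tableau in a cell of its shape. -/
def BoundedSSYT.entry {μ : YoungDiagram} {n : ℕ} (T : BoundedSSYT μ n) (c : μ.cells) : Fin n :=
  ⟨T.1 c.1.1 c.1.2, T.2 c.1 c.2⟩

instance (μ : YoungDiagram) (n : ℕ) : Finite (BoundedSSYT μ n) := by
  refine Finite.of_injective (fun T : BoundedSSYT μ n => T.entry) fun S T h => Subtype.ext ?_
  ext i j
  by_cases hc : (i, j) ∈ μ.cells
  · exact congrArg Fin.val (congrFun h ⟨(i, j), hc⟩)
  · rw [S.1.zeros (by simpa using hc), T.1.zeros (by simpa using hc)]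

noncomputable instance (μ : YoungDiagram) (n : ℕ) : Fintype (BoundedSSYT μ n) :=
  Fintype.ofFinite _

/-- The Schur polynomial `s_μ` in `n` variables, evaluated at `x`. -/
noncomputable def schur (μ : YoungDiagram) {n : ℕ} (x : Fin n → ℂ) : ℂ :=
  ∑ T : BoundedSSYT μ n, ∏ c : μ.cells, x (T.entry c)

/-- The normalized Schur polynomial `s_μ(x_1, …, x_k, 1^{N - k}) / s_μ(1^N)`, for `k ≤ N`. -/
noncomputable def normalizedSchur (μ : YoungDiagram) {k : ℕ} (x : Fin k → ℂ) (N : ℕ) : ℂ :=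
  schur μ (fun i : Fin N => if h : (i : ℕ) < k then x ⟨i, h⟩ else 1) /
    schur μ (fun _ : Fin N => 1)

/-- The rectangular partition `(a^b)`: `b` rows of length `a`. -/
def rectangle (a b : ℕ) : YoungDiagram where
  cells := Finset.range b ×ˢ Finset.range a
  isLowerSet := by
    rintro ⟨i, j⟩ ⟨i', j'⟩ ⟨hi, hj⟩ h
    simp only [Finset.coe_product, Finset.coe_range, Set.mem_prod, Set.mem_Iio] at h ⊢
    exact ⟨lt_of_le_of_lt hi h.1, lt_of_le_of_lt hj h.2⟩

/-! The picture of a plane partition is determined by its surface, seen as a height function on the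
lattice points of the hexagon. Conversely, every tiling has a height function, which counts the
vertical unit segments below a point that are not diagonals of top lozenges, and its super-level
sets on the diagonals form a plane partition. So a random tiling is a random plane partition, and
its left corners of height `ℓ` are the entries `ℓ` with a smaller entry in the next row.

After a rotation by 180°, the cells with entry less than `m` form a partition `λᵐ`, and
`⊥ = λ⁰ ≤ λ¹ ≤ ⋯ ≤ λᶜ⁺¹ = ⊤` in the lattice of partitions in the `a × b` box. Corners of height `ℓ`
correspond to the columns in which the step of index `ℓ` adds cells, so the generating function is
the entry `(⊥, ⊤)` of a product of transfer matrices `growth b`. The Schur polynomial is the same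
entry of a product of matrices `strip`, which add horizontal strips.

The two are linked by the exchange relation `tailStrip k * growth (k + 1) = growth k * tailStrip k`,
which is proved by a Bender–Knuth reflection. For `k ≥ 1` the matrix `tailStrip k` fixes `⊥`, and on
vectors supported on partitions with `k + 1` full rows it acts as `strip`. Hence all the factors
`growth b` can be lowered to `growth 1 = strip` at the cost of `b - 1` factors `strip 1`. The first
step of the chain carries the weight `1` and supplies the remaining factor `strip 1`. -/

/-! ### Partitions in a box and transfer matrices -/

/-- Partitions with at most `b` parts of size at most `a`. The parts are `part 1 ≥ ⋯ ≥ part b`;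
the value `part 0 = a` plays the role of an infinite zeroth part. -/
structure BoxPartition (a b : ℕ) where
  part : ℕ → ℕ
  antitone_part : Antitone part
  part_zero : part 0 = a
  part_of_lt : ∀ i, b < i → part i = 0

namespace BoxPartition

variable {a b : ℕ}

instance : CoeFun (BoxPartition a b) fun _ => ℕ → ℕ := ⟨part⟩

theorem zero_eq (μ : BoxPartition a b) : μ 0 = a := μ.part_zero

theorem anti (μ : BoxPartition a b) {i j : ℕ} (h : i ≤ j) : μ j ≤ μ i := μ.antitone_part h

theorem succ_le (μ : BoxPartition a b) (i : ℕ) : μ (i + 1) ≤ μ i := μ.anti i.le_succ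

theorem le_width (μ : BoxPartition a b) (i : ℕ) : μ i ≤ a :=
  (μ.anti i.zero_le).trans_eq μ.zero_eq

theorem eq_zero (μ : BoxPartition a b) {i : ℕ} (h : b < i) : μ i = 0 := μ.part_of_lt i h

theorem part_injective : Function.Injective (part : BoxPartition a b → ℕ → ℕ) := by
  rintro ⟨f, _, _, _⟩ ⟨g, _, _, _⟩ rfl
  rfl

theorem ext_parts {μ ν : BoxPartition a b} (h : ∀ i, μ (i + 1) = ν (i + 1)) : μ = ν :=
  part_injective <| funext fun i => i.casesOn (μ.zero_eq.trans ν.zero_eq.symm) h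

instance : PartialOrder (BoxPartition a b) := PartialOrder.lift part part_injective

theorem le_def {ν lam : BoxPartition a b} : ν ≤ lam ↔ ∀ i, ν i ≤ lam i := Iff.rfl

instance : Finite (BoxPartition a b) := by
  refine Finite.of_injective
    (fun (μ : BoxPartition a b) (i : Fin (b + 1)) =>
      (⟨μ i, Nat.lt_succ_of_le (μ.le_width i)⟩ : Fin (a + 1))) fun μ ν h => ext_parts fun i => ?_
  by_cases hi : i < b
  · simpa using congrFun h ⟨i + 1, by omega⟩
  · rw [μ.eq_zero (by omega), ν.eq_zero (by omega)]

noncomputable instance : Fintype (BoxPartition a b) := Fintype.ofFinite _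

noncomputable instance : DecidableEq (BoxPartition a b) := Classical.decEq _

instance : BoundedOrder (BoxPartition a b) where
  bot :=
    { part := fun i => if i = 0 then a else 0
      antitone_part := antitone_nat_of_succ_le fun i => by simp
      part_zero := if_pos rfl
      part_of_lt := fun i hi => if_neg (by omega) }
  bot_le μ := le_def.2 fun i => by
    cases i with
    | zero => exact μ.zero_eq.ge
    | succ i => exact Nat.zero_le _
  top :=
    { part := fun i => if i ≤ b then a else 0
      antitone_part := antitone_nat_of_succ_le fun i => by split_ifs <;> omega
      part_zero := if_pos b.zero_le
      part_of_lt := fun i hi => if_neg hi.not_ge }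
  le_top μ := le_def.2 fun i => by
    rcases le_or_gt i b with h | h
    · exact (μ.le_width i).trans_eq (if_pos h).symm
    · exact (μ.eq_zero h).trans_le (Nat.zero_le _)

theorem bot_succ (i : ℕ) : (⊥ : BoxPartition a b) (i + 1) = 0 := rfl

theorem top_of_le {i : ℕ} (h : i ≤ b) : (⊤ : BoxPartition a b) i = a := if_pos h

/-- `λ` is obtained from `ν` by adding cells, at most one in each column below the row `k`. -/
def IsGrowth (k : ℕ) (ν lam : BoxPartition a b) : Prop :=
  ν ≤ lam ∧ ∀ i, k ≤ i → lam (i + 1) ≤ ν i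

/-- `λ` is obtained from `ν` by adding a horizontal strip in the rows below the row `k`. -/
def IsTailStrip (k : ℕ) (ν lam : BoxPartition a b) : Prop :=
  IsGrowth k ν lam ∧ ∀ i ≤ k, lam i = ν i

/-- The number of nonempty columns of `λ / ν`, counted by their uppermost cells. -/
def topCells (ν lam : BoxPartition a b) : ℕ :=
  ∑ i ∈ Finset.range b, (min (lam (i + 1)) (ν i) - ν (i + 1))

/-- The number of cells of `λ / ν` below another cell of `λ / ν`. -/
def lowerCells (ν lam : BoxPartition a b) : ℕ := ∑ i ∈ Finset.range b, (lam (i + 1) - ν i)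

/-- The number of cells of `λ / ν`. -/
def numCells (ν lam : BoxPartition a b) : ℕ := ∑ i ∈ Finset.range b, (lam (i + 1) - ν (i + 1))

variable {R : Type*} [CommSemiring R]

open Classical in
/-- The transfer matrix that adds cells, at most one in each column below the row `k`, with
weight `x` for the uppermost new cell of a column and weight `t` for the others. -/
noncomputable def growth (a b k : ℕ) (x t : R) : Matrix (BoxPartition a b) (BoxPartition a b) R :=
  fun ν lam => if IsGrowth k ν lam then x ^ topCells ν lam * t ^ lowerCells ν lam else 0

open Classical in
/-- The transfer matrix that adds a horizontal strip below the row `k`. -/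
noncomputable def tailStrip (a b k : ℕ) (t : R) :
    Matrix (BoxPartition a b) (BoxPartition a b) R :=
  fun ν lam => if IsTailStrip k ν lam then t ^ numCells ν lam else 0

/-- `μ` lies between `ν` and `λ` below the row `k`, and the skew shapes `μ / ν` and `λ / μ` are
horizontal strips there. -/
def Between (k : ℕ) (ν lam μ : BoxPartition a b) : Prop :=
  ∀ i, k ≤ i → max (ν (i + 1)) (lam (i + 1 + 1)) ≤ μ (i + 1) ∧ μ (i + 1) ≤ min (ν i) (lam (i + 1))

theorem isTailStrip_and_isGrowth_iff {k : ℕ} {ν lam μ : BoxPartition a b} :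
    IsTailStrip k ν μ ∧ IsGrowth (k + 1) μ lam ↔
      ν ≤ lam ∧ (∀ i ≤ k, μ i = ν i) ∧ Between k ν lam μ := by
  constructor
  · rintro ⟨⟨⟨hνμ, hμ⟩, heq⟩, hμlam, hlam⟩
    refine ⟨hνμ.trans hμlam, heq, fun i hi => ?_⟩
    have := le_def.1 hνμ (i + 1)
    have := le_def.1 hμlam (i + 1)
    have := hμ i hi
    have := hlam (i + 1) (by omega)
    omega
  · rintro ⟨hle, heq, hμ⟩
    refine ⟨⟨⟨le_def.2 fun i => ?_, fun i hi => ?_⟩, heq⟩, le_def.2 fun i => ?_, fun i hi => ?_⟩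
    · rcases le_or_gt i k with hi | hi
      · exact (heq i hi).ge
      · obtain ⟨i, rfl⟩ := Nat.exists_eq_add_one.2 (Nat.zero_lt_of_lt hi)
        exact (le_max_left _ _).trans (hμ i (by omega)).1
    · exact (hμ i hi).2.trans (min_le_left _ _)
    · rcases le_or_gt i k with hi | hi
      · exact (heq i hi).trans_le (le_def.1 hle i)
      · obtain ⟨i, rfl⟩ := Nat.exists_eq_add_one.2 (Nat.zero_lt_of_lt hi)
        exact (hμ i (by omega)).2.trans (min_le_right _ _)
    · obtain ⟨i, rfl⟩ := Nat.exists_eq_add_one.2 (Nat.zero_lt_of_lt hi)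
      exact (le_max_right _ _).trans (hμ i (by omega)).1

theorem isGrowth_and_isTailStrip_iff {k : ℕ} {ν lam μ : BoxPartition a b} :
    IsGrowth k ν μ ∧ IsTailStrip k μ lam ↔
      ν ≤ lam ∧ (∀ i ≤ k, μ i = lam i) ∧ Between k ν lam μ := by
  constructor
  · rintro ⟨⟨hνμ, hμ⟩, ⟨hμlam, hlam⟩, heq⟩
    refine ⟨hνμ.trans hμlam, fun i hi => (heq i hi).symm, fun i hi => ?_⟩
    have := le_def.1 hνμ (i + 1)
    have := le_def.1 hμlam (i + 1)
    have := hμ i hi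
    have := hlam (i + 1) (by omega)
    omega
  · rintro ⟨hle, heq, hμ⟩
    refine ⟨⟨le_def.2 fun i => ?_, fun i hi => ?_⟩, ⟨le_def.2 fun i => ?_, fun i hi => ?_⟩,
      fun i hi => (heq i hi).symm⟩
    · rcases le_or_gt i k with hi | hi
      · exact (le_def.1 hle i).trans_eq (heq i hi).symm
      · obtain ⟨i, rfl⟩ := Nat.exists_eq_add_one.2 (Nat.zero_lt_of_lt hi)
        exact (le_max_left _ _).trans (hμ i (by omega)).1
    · exact (hμ i hi).2.trans (min_le_left _ _)
    · rcases le_or_gt i k with hi | hi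
      · exact (heq i hi).le
      · obtain ⟨i, rfl⟩ := Nat.exists_eq_add_one.2 (Nat.zero_lt_of_lt hi)
        exact (hμ i (by omega)).2.trans (min_le_right _ _)
    · rcases hi.eq_or_lt with rfl | hi
      · exact (lam.succ_le k).trans_eq (heq k le_rfl).symm
      · obtain ⟨i, rfl⟩ := Nat.exists_eq_add_one.2 (Nat.zero_lt_of_lt hi)
        exact (le_max_right _ _).trans (hμ i (by omega)).1

/-- The partition that agrees with `f` in the rows up to `k`, and whose lower parts are the
reflections of the parts of `μ` in the midpoints of the ranges allowed by `Between k ν λ`. -/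
def reflect {k : ℕ} {ν lam μ : BoxPartition a b} (f : BoxPartition a b)
    (hf : min (ν k) (lam (k + 1)) ≤ f k) (hμ : Between k ν lam μ) : BoxPartition a b where
  part i := if i ≤ k then f i else max (ν i) (lam (i + 1)) + min (ν (i - 1)) (lam i) - μ i
  antitone_part := antitone_nat_of_succ_le fun i => by
    simp only [add_tsub_cancel_right]
    rcases lt_trichotomy i k with hik | rfl | hik
    · rw [if_pos (Nat.succ_le_of_lt hik), if_pos hik.le]
      exact f.succ_le i
    · have := hμ i le_rfl
      split_ifs <;> omega
    · obtain ⟨i, rfl⟩ := Nat.exists_eq_add_one.2 (Nat.zero_lt_of_lt hik)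
      have := hμ i (by omega)
      have := hμ (i + 1) (by omega)
      rw [if_neg (by omega), if_neg (by omega), add_tsub_cancel_right]
      omega
  part_zero := (if_pos k.zero_le).trans f.zero_eq
  part_of_lt i hi := by
    obtain ⟨i, rfl⟩ := Nat.exists_eq_add_one.2 (Nat.zero_lt_of_lt hi)
    have := f.eq_zero hi
    have := lam.eq_zero hi
    have := hμ i
    split_ifs <;> omega

theorem reflect_of_le {k : ℕ} {ν lam μ f : BoxPartition a b}
    {hf : min (ν k) (lam (k + 1)) ≤ f k} {hμ : Between k ν lam μ} {i : ℕ} (hi : i ≤ k) :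
    reflect f hf hμ i = f i := if_pos hi

theorem reflect_succ {k : ℕ} {ν lam μ f : BoxPartition a b}
    {hf : min (ν k) (lam (k + 1)) ≤ f k} {hμ : Between k ν lam μ} {i : ℕ} (hi : k ≤ i) :
    reflect f hf hμ (i + 1) =
      max (ν (i + 1)) (lam (i + 1 + 1)) + min (ν i) (lam (i + 1)) - μ (i + 1) :=
  if_neg (by omega)

theorem between_reflect {k : ℕ} {ν lam μ f : BoxPartition a b}
    {hf : min (ν k) (lam (k + 1)) ≤ f k} {hμ : Between k ν lam μ} :
    Between k ν lam (reflect f hf hμ) := by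
  intro i hi
  have := hμ i hi
  rw [reflect_succ hi]
  omega

theorem reflect_reflect {k : ℕ} {ν lam μ f g : BoxPartition a b}
    {hf : min (ν k) (lam (k + 1)) ≤ f k} {hg : min (ν k) (lam (k + 1)) ≤ g k}
    {hμ : Between k ν lam μ} (hgμ : ∀ i ≤ k, μ i = g i) :
    reflect g hg (between_reflect (hf := hf) (hμ := hμ)) = μ := by
  refine ext_parts fun i => ?_
  by_cases hi : i + 1 ≤ k
  · rw [reflect_of_le hi, hgμ _ hi]
  · have := hμ i (by omega)
    rw [reflect_succ (by omega), reflect_succ (by omega)]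
    omega

/-- The number of cells of `λ / ν` in row `i + 1` below another cell of `λ / ν`, except that the
rows up to `k + 1` are disregarded. It is the amount by which the contributions of row `i` to the
exponents in the two orders of the transfer matrices differ. -/
def lowerCellsInRow (k : ℕ) (ν lam : BoxPartition a b) (i : ℕ) : ℕ :=
  if i ≤ k then 0 else lam (i + 1) - ν i

theorem sum_lowerCellsInRow_succ (k : ℕ) (ν lam : BoxPartition a b) :
    ∑ i ∈ Finset.range b, lowerCellsInRow k ν lam (i + 1) =
      ∑ i ∈ Finset.range b, lowerCellsInRow k ν lam i := by
  have h0 : lowerCellsInRow k ν lam 0 = 0 := if_pos k.zero_le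
  have hb : lowerCellsInRow k ν lam b = 0 := by
    rw [lowerCellsInRow, lam.eq_zero b.lt_succ_self, Nat.zero_sub, ite_self]
  rw [← add_zero (∑ i ∈ _, lowerCellsInRow k ν lam (i + 1)), ← h0, ← Finset.sum_range_succ',
    Finset.sum_range_succ, hb, add_zero]

section Exponents

variable {k : ℕ} {ν lam μ : BoxPartition a b} {hlam : min (ν k) (lam (k + 1)) ≤ lam k}

theorem topCells_row_reflect (heq : ∀ i ≤ k, μ i = ν i) (hμ : Between k ν lam μ) (i : ℕ) :
    min (lam (i + 1)) (μ i) - μ (i + 1) + lowerCellsInRow k ν lam (i + 1) =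
      min (reflect lam hlam hμ (i + 1)) (ν i) - ν (i + 1) + lowerCellsInRow k ν lam i := by
  unfold lowerCellsInRow
  rcases lt_trichotomy i k with hik | rfl | hik
  · rw [reflect_of_le (Nat.succ_le_of_lt hik), heq i hik.le, heq (i + 1) hik, if_pos hik.le,
      if_pos (Nat.succ_le_of_lt hik)]
  · have := hμ i le_rfl
    rw [reflect_succ le_rfl, heq i le_rfl, if_neg (by omega), if_pos le_rfl]
    omega
  · obtain ⟨i, rfl⟩ := Nat.exists_eq_add_one.2 (Nat.zero_lt_of_lt hik)
    have := hμ (i + 1) hik.le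
    have := hμ i (by omega)
    rw [reflect_succ hik.le, if_neg (by omega), if_neg (by omega)]
    omega

theorem cells_row_reflect (heq : ∀ i ≤ k, μ i = ν i) (hμ : Between k ν lam μ) (i : ℕ) :
    μ (i + 1) - ν (i + 1) + (lam (i + 1) - μ i) + lowerCellsInRow k ν lam i =
      reflect lam hlam hμ (i + 1) - ν i + (lam (i + 1) - reflect lam hlam hμ (i + 1)) +
        lowerCellsInRow k ν lam (i + 1) := by
  unfold lowerCellsInRow
  rcases lt_trichotomy i k with hik | rfl | hik
  · rw [reflect_of_le (Nat.succ_le_of_lt hik), heq i hik.le, heq (i + 1) hik, if_pos hik.le,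
      if_pos (Nat.succ_le_of_lt hik), tsub_self, tsub_self, zero_add,
      add_zero, add_zero]
  · have := hμ i le_rfl
    rw [reflect_succ le_rfl, heq i le_rfl, if_pos le_rfl, if_neg (by omega)]
    omega
  · obtain ⟨i, rfl⟩ := Nat.exists_eq_add_one.2 (Nat.zero_lt_of_lt hik)
    have := hμ (i + 1) hik.le
    have := hμ i (by omega)
    rw [reflect_succ hik.le, if_neg (by omega), if_neg (by omega)]
    omega

theorem topCells_reflect (heq : ∀ i ≤ k, μ i = ν i) (hμ : Between k ν lam μ) :
    topCells ν (reflect lam hlam hμ) = topCells μ lam := by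
  have h := Finset.sum_congr rfl fun i (_ : i ∈ Finset.range b) =>
    topCells_row_reflect (hlam := hlam) heq hμ i
  rw [Finset.sum_add_distrib, Finset.sum_add_distrib, sum_lowerCellsInRow_succ] at h
  exact (add_right_cancel h).symm

theorem lowerCells_add_numCells_reflect (heq : ∀ i ≤ k, μ i = ν i) (hμ : Between k ν lam μ) :
    lowerCells ν (reflect lam hlam hμ) + numCells (reflect lam hlam hμ) lam =
      numCells ν μ + lowerCells μ lam := by
  have h := Finset.sum_congr rfl fun i (_ : i ∈ Finset.range b) =>
    cells_row_reflect (hlam := hlam) heq hμ i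
  simp only [Finset.sum_add_distrib, sum_lowerCellsInRow_succ] at h
  exact (add_right_cancel h).symm

end Exponents

theorem tailStrip_mul_growth (k : ℕ) (x t : R) :
    tailStrip a b k t * growth a b (k + 1) x t = growth a b k x t * tailStrip a b k t := by
  classical
  ext ν lam
  simp only [Matrix.mul_apply, tailStrip, growth, ite_zero_mul_ite_zero,
    isTailStrip_and_isGrowth_iff, isGrowth_and_isTailStrip_iff]
  rw [← Finset.sum_filter, ← Finset.sum_filter]
  have hν : min (ν k) (lam (k + 1)) ≤ ν k := min_le_left _ _
  have hlam : min (ν k) (lam (k + 1)) ≤ lam k := min_le_of_right_le (lam.succ_le k)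
  refine Finset.sum_bij'
    (fun μ hμ => reflect lam hlam (Finset.mem_filter.1 hμ).2.2.2)
    (fun μ hμ => reflect ν hν (Finset.mem_filter.1 hμ).2.2.2)
    (fun μ hμ => ?_) (fun μ hμ => ?_)
    (fun μ hμ => reflect_reflect (Finset.mem_filter.1 hμ).2.2.1)
    (fun μ hμ => reflect_reflect (Finset.mem_filter.1 hμ).2.2.1) (fun μ hμ => ?_) <;>
    obtain ⟨-, hle, heq, hbetween⟩ := Finset.mem_filter.1 hμ
  · exact Finset.mem_filter.2 ⟨Finset.mem_univ _, hle, fun i => reflect_of_le, between_reflect⟩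
  · exact Finset.mem_filter.2 ⟨Finset.mem_univ _, hle, fun i => reflect_of_le, between_reflect⟩
  · rw [topCells_reflect heq, mul_assoc, ← pow_add, lowerCells_add_numCells_reflect heq,
      mul_left_comm, ← pow_add]

/-- The transfer matrix that adds a horizontal strip. -/
noncomputable def strip (a b : ℕ) (x : R) : Matrix (BoxPartition a b) (BoxPartition a b) R :=
  tailStrip a b 0 x

theorem isTailStrip_zero_iff {ν lam : BoxPartition a b} :
    IsTailStrip 0 ν lam ↔ ν ≤ lam ∧ ∀ i, lam (i + 1) ≤ ν i := by
  simp [IsTailStrip, IsGrowth, ν.zero_eq, lam.zero_eq]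

theorem isGrowth_iff_of_le_one {k : ℕ} (hk : k ≤ 1) {ν lam : BoxPartition a b} :
    IsGrowth k ν lam ↔ IsTailStrip 0 ν lam := by
  rw [isTailStrip_zero_iff]
  refine and_congr_right fun _ => ⟨fun h i => ?_, fun h i _ => h i⟩
  rcases i with _ | i
  · exact (lam.le_width 1).trans_eq ν.zero_eq.symm
  · exact h _ (by omega)

theorem growth_of_le_one {k : ℕ} (hk : k ≤ 1) (x t : R) : growth a b k x t = strip a b x := by
  ext ν lam
  by_cases h : IsTailStrip 0 ν lam
  · rw [growth, strip, tailStrip, if_pos ((isGrowth_iff_of_le_one hk).2 h), if_pos h]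
    have hstrip := (isTailStrip_zero_iff.1 h).2
    have htop : topCells ν lam = numCells ν lam :=
      Finset.sum_congr rfl fun i _ => by rw [min_eq_left (hstrip i)]
    have hlower : lowerCells ν lam = 0 :=
      Finset.sum_eq_zero fun i _ => Nat.sub_eq_zero_of_le (hstrip i)
    rw [htop, hlower, pow_zero, mul_one]
  · rw [growth, strip, tailStrip, if_neg (mt (isGrowth_iff_of_le_one hk).1 h), if_neg h]

theorem strip_commute (x t : R) : Commute (strip a b x) (strip a b t) := by
  have h := tailStrip_mul_growth (a := a) (b := b) 0 x t
  rw [growth_of_le_one le_rfl, growth_of_le_one zero_le_one] at h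
  exact h.symm

theorem isTailStrip_bot_iff {k : ℕ} (hk : 1 ≤ k) {lam : BoxPartition a b} :
    IsTailStrip k ⊥ lam ↔ lam = ⊥ := by
  refine ⟨fun ⟨h, heq⟩ => ext_parts fun i => ?_, ?_⟩
  · by_cases hi : i + 1 ≤ k
    · exact heq _ hi
    · obtain ⟨i, rfl⟩ := Nat.exists_eq_add_one.2 (show 0 < i by omega)
      exact Nat.le_zero.1 (h.2 (i + 1) (by omega))
  · rintro rfl
    exact ⟨⟨le_rfl, fun i _ => succ_le _ i⟩, fun _ _ => rfl⟩

theorem tailStrip_bot {k : ℕ} (hk : 1 ≤ k) (t : R) : tailStrip a b k t ⊥ = Pi.single ⊥ 1 := by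
  ext lam
  simp only [tailStrip, isTailStrip_bot_iff hk, Pi.single_apply]
  split_ifs with h
  · simp [h, numCells]
  · rfl

theorem isTailStrip_iff_of_eq_width {k : ℕ} {ν lam : BoxPartition a b} (hlam : lam (k + 1) = a) :
    IsTailStrip k ν lam ↔ IsTailStrip 0 ν lam := by
  have hfull : ∀ i ≤ k + 1, lam i = a := fun i hi =>
    (lam.le_width i).antisymm (hlam.ge.trans (lam.anti hi))
  rw [isTailStrip_zero_iff]
  refine ⟨fun ⟨h, heq⟩ => ⟨h.1, fun i => ?_⟩,
    fun h => ⟨⟨h.1, fun i _ => h.2 i⟩, fun i hi => le_antisymm ?_ (le_def.1 h.1 i)⟩⟩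
  · by_cases hi : k ≤ i
    · exact h.2 i hi
    · exact (lam.succ_le i).trans_eq (heq i (by omega))
  · exact (hfull i (by omega)).trans_le ((hfull (i + 1) (by omega)).ge.trans (h.2 i))

theorem tailStrip_mulVec_eq_strip_mulVec {k : ℕ} {w : BoxPartition a b → R} (t : R)
    (hw : ∀ lam, w lam ≠ 0 → lam (k + 1) = a) :
    (tailStrip a b k t).mulVec w = (strip a b t).mulVec w := by
  classical
  ext ν
  refine Finset.sum_congr rfl fun lam _ => ?_
  by_cases h0 : w lam = 0
  · rw [h0, mul_zero, mul_zero]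
  · simp only [strip, tailStrip, isTailStrip_iff_of_eq_width (hw lam h0)]

theorem eq_width_of_strip_mulVec_ne_zero {k : ℕ} {w : BoxPartition a b → R} {t : R}
    (hw : ∀ lam, w lam ≠ 0 → lam (k + 1) = a) {ν : BoxPartition a b}
    (hν : (strip a b t).mulVec w ν ≠ 0) : ν k = a := by
  obtain ⟨lam, -, h⟩ := Finset.exists_ne_zero_of_sum_ne_zero hν
  have hstrip : IsTailStrip 0 ν lam := by
    by_contra hn
    exact h (by simp only [strip, tailStrip, if_neg hn, zero_mul])
  refine (ν.le_width k).antisymm ?_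
  exact (hw lam (right_ne_zero_of_mul h)).ge.trans ((isTailStrip_zero_iff.1 hstrip).2 k)

theorem tailStrip_mul_list_prod_growth (k : ℕ) (t : R) (xs : List R) :
    tailStrip a b k t * (xs.map fun x => growth a b (k + 1) x t).prod =
      (xs.map fun x => growth a b k x t).prod * tailStrip a b k t := by
  induction xs with
  | nil => simp
  | cons x xs ih =>
    simp only [List.map_cons, List.prod_cons]
    rw [← mul_assoc, tailStrip_mul_growth, mul_assoc, ih, mul_assoc]

theorem list_prod_growth_succ_mulVec_bot {k : ℕ} (hk : 1 ≤ k) (t : R) (xs : List R)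
    {w : BoxPartition a b → R} (hw : ∀ lam, w lam ≠ 0 → lam (k + 1) = a) :
    (xs.map fun x => growth a b (k + 1) x t).prod.mulVec w ⊥ =
      (xs.map fun x => growth a b k x t).prod.mulVec ((strip a b t).mulVec w) ⊥ := by
  rw [← tailStrip_mulVec_eq_strip_mulVec t hw, Matrix.mulVec_mulVec,
    ← tailStrip_mul_list_prod_growth, ← Matrix.mulVec_mulVec]
  conv_rhs => rw [Matrix.mulVec, tailStrip_bot hk, single_one_dotProduct]

theorem eq_width_of_strip_pow_mulVec_ne_zero {m k : ℕ} (hk : k + m = b) {t : R}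
    {lam : BoxPartition a b} (h : (strip a b t ^ m).mulVec (Pi.single ⊤ 1) lam ≠ 0) :
    lam k = a := by
  induction m generalizing k lam with
  | zero =>
    rw [pow_zero, Matrix.one_mulVec, Pi.single_apply, ite_ne_right_iff] at h
    rw [h.1, top_of_le (by omega)]
  | succ m ih =>
    rw [pow_succ', ← Matrix.mulVec_mulVec] at h
    exact eq_width_of_strip_mulVec_ne_zero (fun lam => ih (k := k + 1) (by omega)) h

theorem list_prod_growth_mulVec_bot (t : R) (xs : List R) {m k : ℕ} (hk : k + 1 + m = b) :
    (xs.map fun x => growth a b b x t).prod.mulVec (Pi.single ⊤ 1) ⊥ =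
      (xs.map fun x => growth a b (k + 1) x t).prod.mulVec
        ((strip a b t ^ m).mulVec (Pi.single ⊤ 1)) ⊥ := by
  induction m generalizing k with
  | zero => rw [pow_zero, Matrix.one_mulVec, ← hk, add_zero]
  | succ m ih =>
    rw [pow_succ', ← Matrix.mulVec_mulVec, ih (k := k + 1) (by omega)]
    exact list_prod_growth_succ_mulVec_bot (by omega) t xs fun lam =>
      eq_width_of_strip_pow_mulVec_ne_zero (by omega)

theorem list_prod_growth_apply_bot_top (hb : 0 < b) (t : R) (xs : List R) :
    (xs.map fun x => growth a b b x t).prod ⊥ ⊤ =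
      ((xs.map fun x => strip a b x).prod * strip a b t ^ (b - 1)) ⊥ ⊤ := by
  have h := list_prod_growth_mulVec_bot (a := a) t xs
    (show 0 + 1 + (b - 1) = b by rw [zero_add, Nat.add_sub_cancel' hb])
  rw [Matrix.mulVec_mulVec] at h
  simpa [growth_of_le_one] using h

end BoxPartition

/-! ### Reverse plane partitions and chains of partitions -/

theorem lt_card_filter_univ_iff {n : ℕ} {P : Fin n → Prop} [DecidablePred P] (hP : Antitone P)
    (j : Fin n) : j < (Finset.univ.filter P).card ↔ P j := by
  refine ⟨fun h => ?_, fun h => ?_⟩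
  · by_contra hj
    refine h.not_ge ?_
    rw [← Fin.card_Iio]
    refine Finset.card_le_card fun k hk => Finset.mem_Iio.2 (lt_of_not_ge fun hjk => hj ?_)
    exact hP hjk (Finset.mem_filter.1 hk).2
  · rw [← Nat.succ_le_iff, Nat.succ_eq_add_one, ← Fin.card_Iic]
    refine Finset.card_le_card fun k hk => Finset.mem_filter.2 ⟨Finset.mem_univ k, ?_⟩
    exact hP (Finset.mem_Iic.1 hk) h

theorem card_filter_le_val_and_val_lt {a l u : ℕ} (hu : u ≤ a) :
    (Finset.univ.filter fun j : Fin a => l ≤ j ∧ j < u).card = u - l := by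
  rw [← Nat.card_Ico, ← Finset.card_map Fin.valEmbedding]
  congr 1
  ext j
  simp only [Finset.mem_map, Finset.mem_filter, Finset.mem_univ, true_and, Fin.valEmbedding_apply,
    Finset.mem_Ico]
  exact ⟨fun ⟨_, hk, hkj⟩ => hkj ▸ hk, fun hj => ⟨⟨j, hj.2.trans_le hu⟩, hj, rfl⟩⟩

theorem list_ofFn_prod_apply {S R : Type*} [Fintype S] [DecidableEq S] [CommSemiring R] {n : ℕ}
    (W : Fin n → Matrix S S R) (u v : S) :
    (List.ofFn W).prod u v = ∑ κ : Fin (n + 1) → S,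
      if κ 0 = u ∧ κ (Fin.last n) = v then ∏ m : Fin n, W m (κ m.castSucc) (κ m.succ) else 0 := by
  induction n generalizing u with
  | zero =>
    rw [← (Equiv.funUnique (Fin 1) S).symm.sum_comp, Finset.sum_eq_single u]
    · simp [Matrix.one_apply]
    · intro w _ hw
      simp [hw]
    · exact fun h => absurd (Finset.mem_univ u) h
  | succ n ih =>
    rw [List.ofFn_succ, List.prod_cons, Matrix.mul_apply,
      ← (Fin.consEquiv fun _ => S).sum_comp, Fintype.sum_prod_type_right]
    simp only [ih, Finset.mul_sum, Fin.consEquiv_apply, Fin.cons_zero, ← Fin.succ_last,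
      Fin.cons_succ, Fin.prod_univ_succ, Fin.castSucc_zero, ← Fin.succ_castSucc]
    rw [Finset.sum_comm]
    refine Finset.sum_congr rfl fun κ _ => ?_
    simp [ite_and, Finset.sum_ite_eq]

namespace BoxPartition

variable {a b : ℕ}

theorem le_iff_forall_lt {μ ν : BoxPartition a b} :
    μ ≤ ν ↔ ∀ (i : Fin b) (j : Fin a), j < μ (i + 1) → j < ν (i + 1) := by
  refine ⟨fun h i j hj => hj.trans_le (le_def.1 h _), fun h => le_def.2 fun i => ?_⟩
  rcases i with _ | i
  · exact (μ.zero_eq.trans ν.zero_eq.symm).le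
  by_cases hi : i < b
  · exact le_of_forall_lt fun j hj => h ⟨i, hi⟩ ⟨j, hj.trans_le (μ.le_width _)⟩ hj
  · exact (μ.eq_zero (by omega)).trans_le (Nat.zero_le _)

theorem ext_lt {μ ν : BoxPartition a b}
    (h : ∀ (i : Fin b) (j : Fin a), j < μ (i + 1) ↔ j < ν (i + 1)) : μ = ν :=
  le_antisymm (le_iff_forall_lt.2 fun i j => (h i j).1) (le_iff_forall_lt.2 fun i j => (h i j).2)

theorem numCells_eq_card (ν lam : BoxPartition a b) :
    numCells ν lam = (Finset.univ.filter fun p : Fin b × Fin a =>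
      ν (p.1 + 1) ≤ p.2 ∧ p.2 < lam (p.1 + 1)).card := by
  simp only [numCells, Finset.card_filter, Fintype.sum_prod_type, Finset.sum_range]
  refine Finset.sum_congr rfl fun i _ => ?_
  rw [← Finset.card_filter, card_filter_le_val_and_val_lt (lam.le_width _)]

theorem topCells_eq_card (ν lam : BoxPartition a b) :
    topCells ν lam = (Finset.univ.filter fun p : Fin b × Fin a =>
      ν (p.1 + 1) ≤ p.2 ∧ p.2 < lam (p.1 + 1) ∧ p.2 < ν p.1).card := by
  simp only [topCells, Finset.card_filter, Fintype.sum_prod_type, Finset.sum_range, ← lt_min_iff]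
  refine Finset.sum_congr rfl fun i _ => ?_
  rw [← Finset.card_filter,
    card_filter_le_val_and_val_lt ((min_le_left _ _).trans (lam.le_width _))]

end BoxPartition

/-- Fillings of the `b × a` rectangle with numbers less than `n` that increase weakly along rows
and columns. -/
abbrev ReversePlanePartition (a b n : ℕ) := Fin b × Fin a →o Fin n

namespace ReversePlanePartition

open BoxPartition

variable {a b n : ℕ}

noncomputable instance : Fintype (ReversePlanePartition a b n) :=
  @Fintype.ofFinite _ (DFunLike.finite _)

/-- The partition formed by the cells with entries less than `m`. -/
def sublevel (A : ReversePlanePartition a b n) (m : ℕ) : BoxPartition a b where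
  part
    | 0 => a
    | i + 1 => if h : i < b then (Finset.univ.filter fun j => A (⟨i, h⟩, j) < m).card else 0
  antitone_part := antitone_nat_of_succ_le fun i => by
    rcases i with _ | i
    · dsimp only
      split_ifs
      · exact (Finset.card_filter_le _ _).trans_eq (Finset.card_fin a)
      · exact a.zero_le
    · dsimp only
      split_ifs
      · refine Finset.card_le_card (Finset.monotone_filter_right _ fun j _ hj => ?_)
        exact lt_of_le_of_lt (A.monotone (Prod.mk_le_mk.2 ⟨Fin.mk_le_mk.2 i.le_succ, le_rfl⟩)) hj
      · omega
      · exact Nat.zero_le _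
      · exact le_rfl
  part_zero := rfl
  part_of_lt i hi := by
    obtain ⟨i, rfl⟩ := Nat.exists_eq_add_one.2 (Nat.zero_lt_of_lt hi)
    exact dif_neg (by omega)

theorem lt_sublevel_iff (A : ReversePlanePartition a b n) (m : ℕ) (i : Fin b) (j : Fin a) :
    j < A.sublevel m (i + 1) ↔ A (i, j) < m := by
  have h : A.sublevel m (i + 1) = (Finset.univ.filter fun j => A (i, j) < m).card :=
    dif_pos i.is_lt
  rw [h]
  exact lt_card_filter_univ_iff (P := fun j => A (i, j) < m)
    (fun j k hjk hk => lt_of_le_of_lt (A.monotone (Prod.mk_le_mk.2 ⟨le_rfl, hjk⟩)) hk) j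

theorem sublevel_mono (A : ReversePlanePartition a b n) : Monotone A.sublevel := fun m m' h =>
  le_iff_forall_lt.2 fun i j hj =>
    (A.lt_sublevel_iff m' i j).2 (((A.lt_sublevel_iff m i j).1 hj).trans_le h)

theorem sublevel_zero (A : ReversePlanePartition a b n) : A.sublevel 0 = ⊥ :=
  ext_lt fun i j => by
    rw [lt_sublevel_iff, bot_succ]
    exact iff_of_false (Nat.not_lt_zero _) (Nat.not_lt_zero _)

theorem sublevel_last (A : ReversePlanePartition a b n) : A.sublevel n = ⊤ :=
  ext_lt fun i j => by
    rw [lt_sublevel_iff, top_of_le i.is_lt]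
    exact iff_of_true (A (i, j)).is_lt j.is_lt

theorem ext_sublevel {A B : ReversePlanePartition a b n}
    (h : ∀ m ≤ n, A.sublevel m = B.sublevel m) : A = B := by
  refine OrderHom.ext _ _ (funext fun p => eq_of_forall_gt_iff fun m => ?_)
  have := A.lt_sublevel_iff m p.1 p.2
  rwa [h m m.is_lt.le, lt_sublevel_iff, Iff.comm] at this

theorem exists_sublevel_eq {κ : Fin (n + 1) → BoxPartition a b} (hκ : Monotone κ)
    (h0 : κ 0 = ⊥) (h1 : κ (Fin.last n) = ⊤) :
    ∃ A : ReversePlanePartition a b n, ∀ m : Fin (n + 1), A.sublevel m = κ m := by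
  let level (p : Fin b × Fin a) : ℕ := (Finset.univ.filter fun m => κ m (p.1 + 1) ≤ p.2).card
  have lt_level (p : Fin b × Fin a) (m : Fin (n + 1)) : m < level p ↔ κ m (p.1 + 1) ≤ p.2 :=
    lt_card_filter_univ_iff (fun m m' h h' => (le_def.1 (hκ h) _).trans h') m
  have level_pos (p : Fin b × Fin a) : 0 < level p :=
    (lt_level p 0).2 (by rw [h0, bot_succ]; exact Nat.zero_le _)
  have level_le (p : Fin b × Fin a) : level p ≤ n := by
    refine not_lt.1 fun h => ((lt_level p (Fin.last n)).1 h).not_gt ?_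
    rw [h1, top_of_le p.1.is_lt]
    exact p.2.is_lt
  have level_mono : Monotone level := fun p q h => Finset.card_le_card <|
    Finset.monotone_filter_right _ fun m _ hm =>
      ((κ m).anti (Nat.succ_le_succ h.1)).trans (hm.trans h.2)
  refine ⟨⟨fun p => ⟨level p - 1, by have := level_pos p; have := level_le p; omega⟩,
    fun p q h => Nat.sub_le_sub_right (level_mono h) 1⟩, fun m => ext_lt fun i j => ?_⟩
  rw [lt_sublevel_iff]
  have : (m : ℕ) < level (i, j) ↔ κ m (i + 1) ≤ j := lt_level (i, j) m
  have := level_pos (i, j)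
  change level (i, j) - 1 < (m : ℕ) ↔ _
  omega

theorem list_prod_ofFn_apply_bot_top {R : Type*} [CommSemiring R]
    (W : Fin n → Matrix (BoxPartition a b) (BoxPartition a b) R)
    (hW : ∀ m ν lam, W m ν lam ≠ 0 → ν ≤ lam) :
    (List.ofFn W).prod ⊥ ⊤ = ∑ A : ReversePlanePartition a b n,
      ∏ m : Fin n, W m (A.sublevel m) (A.sublevel (m + 1)) := by
  rw [list_ofFn_prod_apply]
  refine (Fintype.sum_of_injective
    (fun (A : ReversePlanePartition a b n) (m : Fin (n + 1)) => A.sublevel m)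
    (fun A B h => ext_sublevel fun m hm => congrFun h ⟨m, Nat.lt_succ_of_le hm⟩) _ _
    (fun κ hκ => ?_) fun A => ?_).symm
  · rw [ite_eq_right_iff]
    rintro ⟨h0, h1⟩
    by_contra hne
    have hmono : Monotone κ := Fin.monotone_iff_le_succ.2 fun m =>
      hW m _ _ fun h => hne (Finset.prod_eq_zero (Finset.mem_univ m) h)
    obtain ⟨A, hA⟩ := exists_sublevel_eq hmono h0 h1
    exact hκ ⟨A, funext hA⟩
  · rw [if_pos ⟨A.sublevel_zero, A.sublevel_last⟩]
    rfl

theorem numCells_sublevel (A : ReversePlanePartition a b n) (m : Fin n) :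
    numCells (A.sublevel m) (A.sublevel (m + 1)) = (Finset.univ.filter fun p => A p = m).card := by
  rw [numCells_eq_card]
  congr 1
  ext ⟨i, j⟩
  have := A.lt_sublevel_iff m i j
  have := A.lt_sublevel_iff (m + 1) i j
  simp only [Finset.mem_filter, Finset.mem_univ, true_and, Fin.ext_iff]
  omega

theorem prod_pow_numCells_sublevel {M : Type*} [CommMonoid M] (A : ReversePlanePartition a b n)
    (x : Fin n → M) :
    ∏ m : Fin n, x m ^ numCells (A.sublevel m) (A.sublevel (m + 1)) = ∏ p, x (A p) := by
  rw [← Finset.prod_fiberwise' Finset.univ A x]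
  exact Finset.prod_congr rfl fun m _ => by rw [Finset.prod_const, numCells_sublevel]

theorem isTailStrip_sublevel_iff (A : ReversePlanePartition a b n) :
    (∀ m : Fin n, IsTailStrip 0 (A.sublevel m) (A.sublevel (m + 1))) ↔
      ∀ j, StrictMono fun i => A (i, j) := by
  simp only [isTailStrip_zero_iff]
  refine ⟨fun h j i i' hi => ?_, fun h m => ⟨A.sublevel_mono (Nat.le_succ m), fun i => ?_⟩⟩
  · have hstep : A.sublevel (A (i', j) + 1) (i' + 1) ≤ A.sublevel (A (i', j)) (i + 1) :=
      ((h (A (i', j))).2 i').trans ((A.sublevel _).anti hi)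
    exact (A.lt_sublevel_iff _ i j).1
      (((A.lt_sublevel_iff _ i' j).2 (Nat.lt_succ_self _)).trans_le hstep)
  · rcases i with _ | i
    · exact (le_width _ 1).trans_eq (zero_eq _).symm
    by_cases hi : i + 1 < b
    · refine le_of_forall_lt fun j hj => ?_
      lift j to Fin a using hj.trans_le (le_width _ _)
      have hA := (A.lt_sublevel_iff _ ⟨i + 1, hi⟩ j).1 hj
      have := h j (show (⟨i, by omega⟩ : Fin b) < ⟨i + 1, hi⟩ from Nat.lt_succ_self i)
      refine (A.lt_sublevel_iff _ ⟨i, by omega⟩ j).2 ?_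
      simp only [Fin.lt_def] at this
      omega
    · exact (eq_zero _ (by omega)).trans_le (Nat.zero_le _)

theorem isGrowth_sublevel (A : ReversePlanePartition a b n) (m : ℕ) :
    IsGrowth b (A.sublevel m) (A.sublevel (m + 1)) :=
  ⟨A.sublevel_mono m.le_succ,
    fun _ hi => (eq_zero _ (Nat.lt_succ_of_le hi)).trans_le (Nat.zero_le _)⟩

end ReversePlanePartition

/-! ### Schur polynomials of rectangular shape -/

theorem mem_cells_rectangle {a b : ℕ} {c : ℕ × ℕ} :
    c ∈ (rectangle a b).cells ↔ c.1 < b ∧ c.2 < a := by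
  simp [rectangle]

namespace BoundedSSYT

open BoxPartition

variable {a b n : ℕ}

/-- A bounded tableau of rectangular shape, regarded as a reverse plane partition. -/
def toReversePlanePartition (T : BoundedSSYT (rectangle a b) n) : ReversePlanePartition a b n where
  toFun p := ⟨T.1 p.1 p.2, T.2 (p.1, p.2) (mem_cells_rectangle.2 ⟨p.1.is_lt, p.2.is_lt⟩)⟩
  monotone' p q h := (T.1.col_weak h.1 (mem_cells_rectangle.2 ⟨q.1.is_lt, p.2.is_lt⟩)).trans
    (T.1.row_weak_of_le h.2 (mem_cells_rectangle.2 ⟨q.1.is_lt, q.2.is_lt⟩))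

theorem toReversePlanePartition_injective :
    Function.Injective (toReversePlanePartition : BoundedSSYT (rectangle a b) n → _) := by
  intro S T h
  refine Subtype.ext (SemistandardYoungTableau.ext fun i j => ?_)
  by_cases hc : (i, j) ∈ rectangle a b
  · obtain ⟨hi, hj⟩ := mem_cells_rectangle.1 hc
    exact congrArg Fin.val (DFunLike.congr_fun h (⟨i, hi⟩, ⟨j, hj⟩))
  · rw [S.1.zeros hc, T.1.zeros hc]

theorem mem_range_toReversePlanePartition {A : ReversePlanePartition a b n} :
    A ∈ Set.range toReversePlanePartition ↔ ∀ j, StrictMono fun i => A (i, j) := by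
  refine ⟨?_, fun hA => ?_⟩
  · rintro ⟨T, rfl⟩ j i i' hi
    exact T.1.col_strict hi (mem_cells_rectangle.2 ⟨i'.is_lt, j.is_lt⟩)
  let T : SemistandardYoungTableau (rectangle a b) :=
    { entry := fun i j => if h : i < b ∧ j < a then A (⟨i, h.1⟩, ⟨j, h.2⟩) else 0
      row_weak' := fun {i j₁ j₂} hj h => by
        have h := mem_cells_rectangle.1 h
        rw [dif_pos h, dif_pos ⟨h.1, hj.trans h.2⟩]
        exact A.monotone (Prod.mk_le_mk.2 ⟨le_rfl, hj.le⟩)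
      col_strict' := fun {i₁ i₂ j} hi h => by
        have h := mem_cells_rectangle.1 h
        rw [dif_pos h, dif_pos ⟨hi.trans h.1, h.2⟩]
        exact hA ⟨j, h.2⟩ (Fin.mk_lt_mk.2 hi)
      zeros' := fun {i j} h => dif_neg (mt mem_cells_rectangle.2 h) }
  have hT (i : Fin b) (j : Fin a) : T i j = A (i, j) := dif_pos ⟨i.is_lt, j.is_lt⟩
  refine ⟨⟨T, fun c hc => ?_⟩, OrderHom.ext _ _ (funext fun p => Fin.ext (hT p.1 p.2))⟩
  obtain ⟨hi, hj⟩ := mem_cells_rectangle.1 hc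
  exact (hT ⟨c.1, hi⟩ ⟨c.2, hj⟩).trans_lt (Fin.is_lt _)

theorem prod_entry {M : Type*} [CommMonoid M] (T : BoundedSSYT (rectangle a b) n) (x : Fin n → M) :
    ∏ c : (rectangle a b).cells, x (T.entry c) = ∏ p, x (T.toReversePlanePartition p) := by
  refine Finset.prod_bij'
    (fun c _ => (⟨c.1.1, (mem_cells_rectangle.1 c.2).1⟩, ⟨c.1.2, (mem_cells_rectangle.1 c.2).2⟩))
    (fun p _ => ⟨(p.1, p.2), mem_cells_rectangle.2 ⟨p.1.is_lt, p.2.is_lt⟩⟩) ?_ ?_ ?_ ?_ ?_ <;>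
    intros <;> first | exact Finset.mem_univ _ | rfl

end BoundedSSYT

section Schur

open BoxPartition

variable {a b n : ℕ}

theorem schur_rectangle (x : Fin n → ℂ) :
    schur (rectangle a b) x = (List.ofFn fun m => strip a b (x m)).prod ⊥ ⊤ := by
  classical
  rw [ReversePlanePartition.list_prod_ofFn_apply_bot_top]
  · refine Fintype.sum_of_injective _ BoundedSSYT.toReversePlanePartition_injective _ _
      (fun A hA => ?_) fun T => ?_
    · simp only [strip, tailStrip, Finset.prod_ite_zero, Finset.mem_univ, true_imp_iff,
        ReversePlanePartition.isTailStrip_sublevel_iff]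
      exact if_neg (mt BoundedSSYT.mem_range_toReversePlanePartition.2 hA)
    · simp only [strip, tailStrip, Finset.prod_ite_zero, Finset.mem_univ, true_imp_iff,
        ReversePlanePartition.isTailStrip_sublevel_iff]
      rw [if_pos (BoundedSSYT.mem_range_toReversePlanePartition.1 ⟨T, rfl⟩),
        ReversePlanePartition.prod_pow_numCells_sublevel, T.prod_entry]
  · intro m ν lam h
    by_contra hle
    exact h (if_neg fun hstrip => hle (isTailStrip_zero_iff.1 hstrip).1)

theorem schur_rectangle_comp_perm (x : Fin n → ℂ) (σ : Equiv.Perm (Fin n)) :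
    schur (rectangle a b) (x ∘ σ) = schur (rectangle a b) x := by
  rw [schur_rectangle, schur_rectangle]
  refine congrFun₂ ((Equiv.Perm.ofFn_comp_perm σ fun m => strip a b (x m)).prod_eq' ?_) ⊥ ⊤
  refine List.pairwise_iff_get.2 fun i j _ => ?_
  simp only [List.get_ofFn]
  exact strip_commute _ _

theorem normalizedSchur_rectangle {c : ℕ} (x : Fin c → ℂ) :
    normalizedSchur (rectangle a b) x (b + c) =
      schur (rectangle a b) (Fin.append (fun _ : Fin b => 1) x) /
        schur (rectangle a b) (fun _ : Fin (b + c) => 1) := by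
  let σ : Equiv.Perm (Fin (b + c)) := finAddFlip.trans (finCongr (add_comm c b))
  have h : (fun i : Fin (b + c) => if h : (i : ℕ) < c then x ⟨i, h⟩ else 1) ∘ σ =
      Fin.append (fun _ : Fin b => 1) x := by
    funext m
    refine Fin.addCases (fun i => ?_) (fun i => ?_) m <;> simp [σ]
  rw [normalizedSchur, ← h, schur_rectangle_comp_perm]

end Schur

/-! ### Corners of plane partitions -/

namespace BoxedPlanePartition

open BoxPartition

variable {a b c : ℕ}

theorem ext_entry {π π' : BoxedPlanePartition a b c}
    (h : ∀ i j, i < b → j < a → π.entry i j = π'.entry i j) : π = π' := by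
  have hentry : π.entry = π'.entry := by
    funext i j
    by_cases hi : i < b
    · by_cases hj : j < a
      · exact h i j hi hj
      · rw [π.cols_le i j (not_lt.1 hj), π'.cols_le i j (not_lt.1 hj)]
    · rw [π.rows_le i j (not_lt.1 hi), π'.rows_le i j (not_lt.1 hi)]
  cases π
  cases π'
  simpa using hentry

theorem entry_anti (π : BoxedPlanePartition a b c) {i i' j j' : ℕ} (hi : i ≤ i') (hj : j ≤ j') :
    π.entry i' j' ≤ π.entry i j :=
  (antitone_nat_of_succ_le (f := fun i => π.entry i j') (fun k => π.col_anti k j') hi).trans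
    (antitone_nat_of_succ_le (f := fun j => π.entry i j) (fun k => π.row_anti i k) hj)

theorem entry_le_height (π : BoxedPlanePartition a b c) (i j : ℕ) : π.entry i j ≤ c :=
  (π.entry_anti (Nat.zero_le i) (Nat.zero_le j)).trans π.entry_le

/-- Rotation of a plane partition by 180 degrees inside its bounding rectangle. -/
def rotate (π : BoxedPlanePartition a b c) : ReversePlanePartition a b (c + 1) where
  toFun p := ⟨π.entry p.1.rev p.2.rev, Nat.lt_succ_of_le (π.entry_le_height _ _)⟩
  monotone' _ _ h := π.entry_anti (Fin.rev_le_rev.2 h.1) (Fin.rev_le_rev.2 h.2)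

theorem coe_rotate (π : BoxedPlanePartition a b c) (p : Fin b × Fin a) :
    (π.rotate p : ℕ) = π.entry p.1.rev p.2.rev := rfl

theorem rotate_injective :
    Function.Injective (rotate : BoxedPlanePartition a b c → _) := by
  intro π π' h
  refine ext_entry fun i j hi hj => ?_
  simpa [coe_rotate] using
    congrArg Fin.val (DFunLike.congr_fun h (Fin.rev ⟨i, hi⟩, Fin.rev ⟨j, hj⟩))

theorem rotate_surjective :
    Function.Surjective (rotate : BoxedPlanePartition a b c → _) := by
  intro A
  let entry (i j : ℕ) : ℕ :=
    if h : i < b ∧ j < a then A (Fin.rev ⟨i, h.1⟩, Fin.rev ⟨j, h.2⟩) else 0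
  have entry_anti {i i' j j' : ℕ} (hi : i ≤ i') (hj : j ≤ j') : entry i' j' ≤ entry i j := by
    by_cases h : i' < b ∧ j' < a
    · simp only [entry, dif_pos h, dif_pos (And.intro (hi.trans_lt h.1) (hj.trans_lt h.2))]
      exact A.monotone (Prod.mk_le_mk.2 ⟨Fin.rev_le_rev.2 hi, Fin.rev_le_rev.2 hj⟩)
    · exact (dif_neg h).trans_le (Nat.zero_le _)
  have entry_le (i j : ℕ) : entry i j ≤ c := by
    by_cases h : i < b ∧ j < a
    · exact (dif_pos h).trans_le (Nat.le_of_lt_succ (Fin.is_lt _))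
    · exact (dif_neg h).trans_le (Nat.zero_le _)
  let π : BoxedPlanePartition a b c :=
    { entry := entry
      row_anti := fun i j => entry_anti le_rfl j.le_succ
      col_anti := fun i j => entry_anti i.le_succ le_rfl
      entry_le := entry_le 0 0
      rows_le := fun i j hi => dif_neg fun h => h.1.not_ge hi
      cols_le := fun i j hj => dif_neg fun h => h.2.not_ge hj }
  refine ⟨π, OrderHom.ext _ _ (funext fun p => Fin.ext ?_)⟩
  exact (dif_pos ⟨p.1.rev.is_lt, p.2.rev.is_lt⟩).trans (by simp only [Fin.eta, Fin.rev_rev])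

noncomputable instance : Fintype (BoxedPlanePartition a b c) :=
  @Fintype.ofFinite _ (Finite.of_injective _ rotate_injective)

/-- The number of lowermost entries equal to `k` in the columns of a plane partition; these are the
left corners of height `k` of its picture. -/
def corners (π : BoxedPlanePartition a b c) (k : ℕ) : ℕ :=
  (Finset.univ.filter fun p : Fin b × Fin a =>
    π.entry p.1 p.2 = k ∧ π.entry (p.1 + 1) p.2 < k).card

theorem lt_sublevel_rotate_iff (π : BoxedPlanePartition a b c) {m : ℕ} (hm : 0 < m) (i : Fin b)
    (j : Fin a) : j < π.rotate.sublevel m i ↔ π.entry (i.rev + 1) j.rev < m := by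
  obtain ⟨i, hi⟩ := i
  rcases i with _ | i
  · rw [zero_eq, π.rows_le _ _ (by rw [Fin.val_rev]; simp only; omega)]
    exact iff_of_true j.is_lt hm
  · have hrev : ((⟨i, Nat.lt_of_succ_lt hi⟩ : Fin b).rev : ℕ) = (⟨i + 1, hi⟩ : Fin b).rev + 1 := by
      simp only [Fin.val_rev]
      omega
    rw [← hrev]
    exact π.rotate.lt_sublevel_iff m ⟨i, _⟩ j

theorem topCells_sublevel_rotate (π : BoxedPlanePartition a b c) (ℓ : ℕ) :
    topCells (π.rotate.sublevel (ℓ + 1)) (π.rotate.sublevel (ℓ + 1 + 1)) = π.corners (ℓ + 1) := by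
  rw [topCells_eq_card, corners]
  refine Finset.card_equiv (Fin.revPerm.prodCongr Fin.revPerm) fun p => ?_
  have h1 := π.rotate.lt_sublevel_iff (ℓ + 1) p.1 p.2
  have h2 := π.rotate.lt_sublevel_iff (ℓ + 1 + 1) p.1 p.2
  simp only [Finset.mem_filter, Finset.mem_univ, true_and, Equiv.prodCongr_apply, Prod.map,
    Fin.revPerm_apply, π.lt_sublevel_rotate_iff ℓ.succ_pos, coe_rotate] at h1 h2 ⊢
  omega

theorem sum_prod_corners_eq_prod_growth {R : Type*} [CommSemiring R] (x : Fin c → R) :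
    ∑ π : BoxedPlanePartition a b c, ∏ ℓ : Fin c, x ℓ ^ π.corners (ℓ + 1) =
      (List.ofFn fun m => growth a b b ((Fin.cons 1 x : Fin (c + 1) → R) m) 1).prod ⊥ ⊤ := by
  classical
  rw [ReversePlanePartition.list_prod_ofFn_apply_bot_top]
  · refine Fintype.sum_bijective rotate ⟨rotate_injective, rotate_surjective⟩ _ _ fun π => ?_
    simp only [growth, if_pos (ReversePlanePartition.isGrowth_sublevel _ _), one_pow, mul_one,
      Fin.prod_univ_succ, Fin.cons_zero, Fin.cons_succ, one_mul, Fin.val_succ,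
      topCells_sublevel_rotate]
  · intro m ν lam h
    by_contra hle
    exact h (if_neg fun hgrowth => hle hgrowth.1)

theorem sum_prod_corners (hb : 0 < b) (x : Fin c → ℂ) :
    ∑ π : BoxedPlanePartition a b c, ∏ ℓ : Fin c, x ℓ ^ π.corners (ℓ + 1) =
      schur (rectangle a b) (Fin.append (fun _ : Fin b => 1) x) := by
  have hgrowth := list_prod_growth_apply_bot_top (a := a) hb 1 (List.ofFn (Fin.cons 1 x))
  rw [List.map_ofFn, List.map_ofFn] at hgrowth
  have happend : (List.ofFn fun m => strip a b (Fin.append (fun _ : Fin b => 1) x m)) =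
      List.replicate b (strip a b 1) ++ List.ofFn fun ℓ => strip a b (x ℓ) := by
    rw [← List.ofFn_const, ← List.ofFn_fin_append]
    congr 1
    funext m
    refine Fin.addCases (fun i => ?_) (fun i => ?_) m <;> simp
  have hcomm : Commute (strip a b 1 ^ (b - 1)) (List.ofFn fun ℓ => strip a b (x ℓ)).prod :=
    Commute.list_prod_right _ _ <| List.forall_mem_ofFn_iff.2 fun ℓ =>
      (strip_commute 1 (x ℓ)).pow_left _
  rw [sum_prod_corners_eq_prod_growth, schur_rectangle, happend, List.prod_append,
    List.prod_replicate, ← mul_pow_sub_one hb.ne', mul_assoc, hcomm.eq, ← mul_assoc]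
  refine hgrowth.trans ?_
  simp only [Function.comp_def, List.ofFn_succ, List.prod_cons, Fin.cons_zero, Fin.cons_succ]

end BoxedPlanePartition

/-! ### Lozenge tilings and height functions -/

section Tilings

variable {a b c : ℕ}

theorem mem_hexagonPoints {u v : ℤ} : (u, v) ∈ hexagonPoints a b c ↔
    -(c : ℤ) ≤ u ∧ u ≤ b ∧ -(c : ℤ) ≤ v ∧ v ≤ a ∧ -(a : ℤ) ≤ u - v ∧ u - v ≤ b := Iff.rfl

theorem pointsLeft_mem_hexagon {u v : ℤ} : ⟨.pointsLeft, (u, v)⟩ ∈ hexagon a b c ↔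
    (u, v) ∈ hexagonPoints a b c ∧ (u + 1, v) ∈ hexagonPoints a b c ∧
      (u + 1, v + 1) ∈ hexagonPoints a b c := by
  simp [hexagon, Triangle.vertices, Set.insert_subset_iff]

theorem pointsRight_mem_hexagon {u v : ℤ} : ⟨.pointsRight, (u, v)⟩ ∈ hexagon a b c ↔
    (u, v) ∈ hexagonPoints a b c ∧ (u, v + 1) ∈ hexagonPoints a b c ∧
      (u + 1, v + 1) ∈ hexagonPoints a b c := by
  simp [hexagon, Triangle.vertices, Set.insert_subset_iff]

theorem top_subset_hexagon {u v : ℤ} :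
    (⟨.top, (u, v)⟩ : Lozenge).triangles ⊆ hexagon a b c ↔
      (u - 1, v - 1) ∈ hexagonPoints a b c ∧ (u, v - 1) ∈ hexagonPoints a b c ∧
        (u - 1, v) ∈ hexagonPoints a b c ∧ (u, v) ∈ hexagonPoints a b c := by
  simp only [Lozenge.triangles, Set.insert_subset_iff, Set.singleton_subset_iff, Prod.mk_sub_mk,
    pointsLeft_mem_hexagon, pointsRight_mem_hexagon, sub_add_cancel]
  tauto

theorem left_subset_hexagon {u v : ℤ} :
    (⟨.left, (u, v)⟩ : Lozenge).triangles ⊆ hexagon a b c ↔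
      (u, v) ∈ hexagonPoints a b c ∧ (u + 1, v) ∈ hexagonPoints a b c ∧
        (u + 1, v + 1) ∈ hexagonPoints a b c ∧ (u, v - 1) ∈ hexagonPoints a b c := by
  simp only [Lozenge.triangles, Set.insert_subset_iff, Set.singleton_subset_iff, Prod.mk_sub_mk,
    pointsLeft_mem_hexagon, pointsRight_mem_hexagon, sub_add_cancel, sub_zero]
  tauto

theorem right_subset_hexagon {u v : ℤ} :
    (⟨.right, (u, v)⟩ : Lozenge).triangles ⊆ hexagon a b c ↔
      (u, v) ∈ hexagonPoints a b c ∧ (u, v + 1) ∈ hexagonPoints a b c ∧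
        (u + 1, v + 1) ∈ hexagonPoints a b c ∧ (u - 1, v) ∈ hexagonPoints a b c := by
  simp only [Lozenge.triangles, Set.insert_subset_iff, Set.singleton_subset_iff, Prod.mk_sub_mk,
    pointsLeft_mem_hexagon, pointsRight_mem_hexagon, sub_add_cancel, sub_zero]
  tauto

theorem pointsLeft_mem_triangles {u v : ℤ} {L : Lozenge} :
    ⟨.pointsLeft, (u, v)⟩ ∈ L.triangles ↔
      L = ⟨.top, (u + 1, v + 1)⟩ ∨ L = ⟨.left, (u, v)⟩ ∨ L = ⟨.right, (u + 1, v)⟩ := by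
  obtain ⟨k, r, s⟩ := L
  cases k <;> simp [Lozenge.triangles] <;> omega

theorem pointsRight_mem_triangles {u v : ℤ} {L : Lozenge} :
    ⟨.pointsRight, (u, v)⟩ ∈ L.triangles ↔
      L = ⟨.top, (u + 1, v + 1)⟩ ∨ L = ⟨.left, (u, v + 1)⟩ ∨ L = ⟨.right, (u, v)⟩ := by
  obtain ⟨k, r, s⟩ := L
  cases k <;> simp [Lozenge.triangles] <;> omega

theorem indicator_one_mem_Icc {α : Type*} (s : Set α) (x : α) :
    s.indicator 1 x ∈ Set.Icc (0 : ℤ) 1 := by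
  by_cases h : x ∈ s <;> simp [h]

theorem existsUnique_mem_triple_iff {α : Type*} {s : Set α} {x y z : α} (hxy : x ≠ y)
    (hxz : x ≠ z) (hyz : y ≠ z) :
    (∃! w, w ∈ s ∧ (w = x ∨ w = y ∨ w = z)) ↔
      s.indicator 1 x + s.indicator 1 y + s.indicator 1 z = (1 : ℤ) := by
  by_cases hx : x ∈ s <;> by_cases hy : y ∈ s <;> by_cases hz : z ∈ s <;>
    simp only [Set.indicator, hx, hy, hz, if_true, if_false, Pi.one_apply, ExistsUnique] <;> grind

theorem existsUnique_pointsLeft_iff {V : Set Lozenge} {u v : ℤ} :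
    (∃! L, L ∈ V ∧ (⟨.pointsLeft, (u, v)⟩ : Triangle) ∈ L.triangles) ↔
      V.indicator 1 ⟨.top, (u + 1, v + 1)⟩ + V.indicator 1 ⟨.left, (u, v)⟩ +
        V.indicator 1 ⟨.right, (u + 1, v)⟩ = (1 : ℤ) := by
  simp only [pointsLeft_mem_triangles]
  exact existsUnique_mem_triple_iff (by simp) (by simp) (by simp)

theorem existsUnique_pointsRight_iff {V : Set Lozenge} {u v : ℤ} :
    (∃! L, L ∈ V ∧ (⟨.pointsRight, (u, v)⟩ : Triangle) ∈ L.triangles) ↔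
      V.indicator 1 ⟨.top, (u + 1, v + 1)⟩ + V.indicator 1 ⟨.left, (u, v + 1)⟩ +
        V.indicator 1 ⟨.right, (u, v)⟩ = (1 : ℤ) := by
  simp only [pointsRight_mem_triangles]
  exact existsUnique_mem_triple_iff (by simp) (by simp) (by simp)

/-- `h` gives the `z`-coordinates of the lattice points in a picture of a pile of cubes with the
set of lozenges `V`. Each rule follows a unit lattice segment, along which the change of the height
depends only on whether the segment is the diagonal of a lozenge of `V`. -/
structure IsHeightFunction (a b c : ℕ) (V : Set Lozenge) (h : ℤ → ℤ → ℤ) : Prop where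
  subset : ∀ L ∈ V, L.triangles ⊆ hexagon a b c
  bottom : ∀ u v, (u, v) ∈ hexagonPoints a b c → u = b ∨ v = a → h u v = 0
  top_rule : ∀ u v, (u, v) ∈ hexagonPoints a b c → (u + 1, v + 1) ∈ hexagonPoints a b c →
    h u v - h (u + 1) (v + 1) = 1 - V.indicator 1 ⟨.top, (u + 1, v + 1)⟩
  left_rule : ∀ u v, (u, v) ∈ hexagonPoints a b c → (u + 1, v) ∈ hexagonPoints a b c →
    h u v - h (u + 1) v = V.indicator 1 ⟨.left, (u, v)⟩
  right_rule : ∀ u v, (u, v) ∈ hexagonPoints a b c → (u, v + 1) ∈ hexagonPoints a b c →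
    h u v - h u (v + 1) = V.indicator 1 ⟨.right, (u, v)⟩

theorem IsHeightFunction.mem_lozengeTilings {T : Finset Lozenge} {h : ℤ → ℤ → ℤ}
    (hh : IsHeightFunction a b c T h) : T ∈ lozengeTilings a b c := by
  refine ⟨hh.subset, ?_⟩
  simp only [← Finset.mem_coe]
  rintro ⟨k, u, v⟩ ht
  cases k
  · rw [existsUnique_pointsLeft_iff]
    obtain ⟨h1, h2, h3⟩ := pointsLeft_mem_hexagon.1 ht
    linarith [hh.top_rule u v h1 h3, hh.left_rule u v h1 h2, hh.right_rule (u + 1) v h2 h3]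
  · rw [existsUnique_pointsRight_iff]
    obtain ⟨h1, h2, h3⟩ := pointsRight_mem_hexagon.1 ht
    linarith [hh.top_rule u v h1 h3, hh.right_rule u v h1 h2, hh.left_rule u (v + 1) h2 h3]

theorem hexagonPoints_induction_up {P : ℤ → ℤ → Prop}
    (base : ∀ u v, (u, v) ∈ hexagonPoints a b c → u = b ∨ v = a → P u v)
    (step : ∀ u v, (u, v) ∈ hexagonPoints a b c → (u + 1, v + 1) ∈ hexagonPoints a b c →
      P (u + 1) (v + 1) → P u v) (u v : ℤ) (h : (u, v) ∈ hexagonPoints a b c) : P u v := by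
  obtain ⟨n, hn⟩ : ∃ n : ℕ, (b : ℤ) - u ≤ n := ⟨_, Int.self_le_toNat _⟩
  induction n generalizing u v with
  | zero =>
    refine base u v h (Or.inl ?_)
    rw [mem_hexagonPoints] at h
    omega
  | succ n ih =>
    by_cases hb : u = b ∨ v = a
    · exact base u v h hb
    · have h' : (u + 1, v + 1) ∈ hexagonPoints a b c := by
        rw [mem_hexagonPoints] at h ⊢
        omega
      exact step u v h h' (ih _ _ h' (by push_cast at hn; omega))

theorem hexagonPoints_induction_down {P : ℤ → ℤ → Prop}
    (base : ∀ u v, (u, v) ∈ hexagonPoints a b c → u = -c ∨ v = -c → P u v)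
    (step : ∀ u v, (u, v) ∈ hexagonPoints a b c → (u + 1, v + 1) ∈ hexagonPoints a b c →
      P u v → P (u + 1) (v + 1)) (u v : ℤ) (h : (u, v) ∈ hexagonPoints a b c) : P u v := by
  obtain ⟨n, hn⟩ : ∃ n : ℕ, (c : ℤ) + u ≤ n := ⟨_, Int.self_le_toNat _⟩
  induction n generalizing u v with
  | zero =>
    refine base u v h (Or.inl ?_)
    rw [mem_hexagonPoints] at h
    omega
  | succ n ih =>
    by_cases hb : u = -c ∨ v = -c
    · exact base u v h hb
    · have h' : (u - 1, v - 1) ∈ hexagonPoints a b c := by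
        rw [mem_hexagonPoints] at h ⊢
        omega
      have := step (u - 1) (v - 1) h' (by simpa using h)
        (ih _ _ h' (by push_cast at hn; omega))
      simpa using this

/-- The height function of a tiling `V`: the number of vertical unit segments below a lattice point
that are not diagonals of top lozenges. -/
noncomputable def tilingHeight (a b : ℕ) (V : Set Lozenge) (u v : ℤ) : ℤ :=
  ∑ m ∈ Finset.range (min ((b : ℤ) - u) (a - v)).toNat,
    (1 - V.indicator 1 ⟨.top, (u + 1 + m, v + 1 + m)⟩)

theorem tilingHeight_top_rule {V : Set Lozenge} {u v : ℤ} (hu : u + 1 ≤ b) (hv : v + 1 ≤ a) :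
    tilingHeight a b V u v - tilingHeight a b V (u + 1) (v + 1) =
      1 - V.indicator 1 ⟨.top, (u + 1, v + 1)⟩ := by
  have hlength : (min ((b : ℤ) - u) (a - v)).toNat =
      (min ((b : ℤ) - (u + 1)) (a - (v + 1))).toNat + 1 := by omega
  rw [tilingHeight, hlength, Finset.sum_range_succ', tilingHeight, sub_eq_iff_eq_add']
  simp only [Nat.cast_zero, add_zero, Nat.cast_add, Nat.cast_one, add_assoc, add_comm (1 : ℤ)]

theorem tilingHeight_bottom {V : Set Lozenge} {u v : ℤ} (h : u = b ∨ v = a) :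
    tilingHeight a b V u v = 0 := by
  rw [tilingHeight, show (min ((b : ℤ) - u) (a - v)).toNat = 0 by omega, Finset.sum_range_zero]

variable {T : Finset Lozenge}

theorem tilingHeight_left_step (hT : T ∈ lozengeTilings a b c) {u v : ℤ}
    (h : (u, v) ∈ hexagonPoints a b c) (h' : (u + 1, v) ∈ hexagonPoints a b c)
    (hright : (u + 1, v + 1) ∈ hexagonPoints a b c →
      tilingHeight a b T (u + 1) v - tilingHeight a b T (u + 1) (v + 1) =
        (T : Set Lozenge).indicator 1 ⟨.right, (u + 1, v)⟩) :
    tilingHeight a b T u v - tilingHeight a b T (u + 1) v =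
      (T : Set Lozenge).indicator 1 ⟨.left, (u, v)⟩ := by
  by_cases hv : v = a
  · have hnot : (⟨.left, (u, v)⟩ : Lozenge) ∉ (T : Set Lozenge) := fun hL => by
      have := mem_hexagonPoints.1 (left_subset_hexagon.1 (hT.1 _ hL)).2.2.1
      omega
    rw [Set.indicator_of_notMem hnot, tilingHeight_bottom (Or.inr hv),
      tilingHeight_bottom (Or.inr hv), sub_zero]
  · rw [mem_hexagonPoints] at h h'
    have h'' : (u + 1, v + 1) ∈ hexagonPoints a b c := by
      rw [mem_hexagonPoints]
      omega
    have htop := tilingHeight_top_rule (a := a) (b := b) (V := T) h'.2.1 h''.2.2.2.1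
    have htriangle := existsUnique_pointsLeft_iff.1
      (hT.2 _ (pointsLeft_mem_hexagon.2 ⟨h, h', h''⟩))
    linarith [hright h'']

theorem tilingHeight_right_step (hT : T ∈ lozengeTilings a b c) {u v : ℤ}
    (h : (u, v) ∈ hexagonPoints a b c) (h' : (u, v + 1) ∈ hexagonPoints a b c)
    (hleft : (u + 1, v + 1) ∈ hexagonPoints a b c →
      tilingHeight a b T u (v + 1) - tilingHeight a b T (u + 1) (v + 1) =
        (T : Set Lozenge).indicator 1 ⟨.left, (u, v + 1)⟩) :
    tilingHeight a b T u v - tilingHeight a b T u (v + 1) =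
      (T : Set Lozenge).indicator 1 ⟨.right, (u, v)⟩ := by
  by_cases hu : u = b
  · have hnot : (⟨.right, (u, v)⟩ : Lozenge) ∉ (T : Set Lozenge) := fun hL => by
      have := mem_hexagonPoints.1 (right_subset_hexagon.1 (hT.1 _ hL)).2.2.1
      omega
    rw [Set.indicator_of_notMem hnot, tilingHeight_bottom (Or.inl hu),
      tilingHeight_bottom (Or.inl hu), sub_zero]
  · rw [mem_hexagonPoints] at h h'
    have h'' : (u + 1, v + 1) ∈ hexagonPoints a b c := by
      rw [mem_hexagonPoints]
      omega
    have htop := tilingHeight_top_rule (a := a) (b := b) (V := T) h''.2.1 h''.2.2.2.1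
    have htriangle := existsUnique_pointsRight_iff.1
      (hT.2 _ (pointsRight_mem_hexagon.2 ⟨h, h', h''⟩))
    linarith [hleft h'']

theorem tilingHeight_side_rules (hT : T ∈ lozengeTilings a b c) {u v : ℤ}
    (h : (u, v) ∈ hexagonPoints a b c) :
    ((u + 1, v) ∈ hexagonPoints a b c → tilingHeight a b T u v - tilingHeight a b T (u + 1) v =
        (T : Set Lozenge).indicator 1 ⟨.left, (u, v)⟩) ∧
      ((u, v + 1) ∈ hexagonPoints a b c → tilingHeight a b T u v - tilingHeight a b T u (v + 1) =
        (T : Set Lozenge).indicator 1 ⟨.right, (u, v)⟩) := by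
  obtain ⟨n, hn⟩ : ∃ n : ℕ, (b : ℤ) - u + (a - v) ≤ n := ⟨_, Int.self_le_toNat _⟩
  induction n generalizing u v with
  | zero => constructor <;> intro h' <;> rw [mem_hexagonPoints] at h h' <;> omega
  | succ n ih =>
    push_cast at hn
    exact ⟨fun h' => tilingHeight_left_step hT h h' (ih h' (by omega)).2,
      fun h' => tilingHeight_right_step hT h h' (ih h' (by omega)).1⟩

theorem isHeightFunction_tilingHeight (hT : T ∈ lozengeTilings a b c) :
    IsHeightFunction a b c T (tilingHeight a b T) where
  subset := hT.1
  bottom _ _ _ := tilingHeight_bottom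
  top_rule _ _ _ h := tilingHeight_top_rule h.2.1 h.2.2.2.1
  left_rule _ _ h := (tilingHeight_side_rules hT h).1
  right_rule _ _ h := (tilingHeight_side_rules hT h).2

end Tilings

namespace IsHeightFunction

variable {a b c : ℕ} {V V' : Set Lozenge} {h h' : ℤ → ℤ → ℤ}

theorem left_side (hh : IsHeightFunction a b c V h) {k : ℕ} (hk : k ≤ c) :
    h (b - k) (-k) = k := by
  induction k with
  | zero => exact hh.bottom _ _ (by rw [mem_hexagonPoints]; omega) (by simp)
  | succ k ih =>
    have hstep := hh.top_rule (b - (k + 1 : ℕ)) (-(k + 1 : ℕ)) (by rw [mem_hexagonPoints]; omega)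
      (by rw [mem_hexagonPoints]; omega)
    rw [show (b : ℤ) - (k + 1 : ℕ) + 1 = b - k by push_cast; ring,
      show -((k + 1 : ℕ) : ℤ) + 1 = -k by push_cast; ring, ih (by omega),
      Set.indicator_of_notMem] at hstep
    · push_cast at hstep ⊢
      omega
    · intro hL
      have := mem_hexagonPoints.1 (top_subset_hexagon.1 (hh.subset _ hL)).2.1
      omega

theorem upper_left_side (hh : IsHeightFunction a b c V h) {k : ℕ} (hk : k ≤ b) :
    h (b - c - k) (-c) = c := by
  induction k with
  | zero => simpa using hh.left_side le_rfl
  | succ k ih =>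
    have hstep := hh.left_rule (b - c - (k + 1 : ℕ)) (-c) (by rw [mem_hexagonPoints]; omega)
      (by rw [mem_hexagonPoints]; omega)
    rw [show (b : ℤ) - c - (k + 1 : ℕ) + 1 = b - c - k by push_cast; ring, ih (by omega),
      Set.indicator_of_notMem] at hstep
    · exact sub_eq_zero.1 hstep
    · intro hL
      have := mem_hexagonPoints.1 (left_subset_hexagon.1 (hh.subset _ hL)).2.2.2
      omega

theorem upper_right_side (hh : IsHeightFunction a b c V h) {k : ℕ} (hk : k ≤ a) :
    h (-c) (-c + k) = c := by
  induction k with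
  | zero => simpa using hh.upper_left_side le_rfl
  | succ k ih =>
    have hstep := hh.right_rule (-c) (-c + k) (by rw [mem_hexagonPoints]; omega)
      (by rw [mem_hexagonPoints]; omega)
    rw [ih (by omega), Set.indicator_of_notMem] at hstep
    · rw [Nat.cast_succ, ← add_assoc, ← sub_eq_zero.1 hstep]
    · intro hL
      have := mem_hexagonPoints.1 (right_subset_hexagon.1 (hh.subset _ hL)).2.2.2
      omega

theorem upper_side (hh : IsHeightFunction a b c V h) {u v : ℤ}
    (hp : (u, v) ∈ hexagonPoints a b c) (huv : u = -c ∨ v = -c) : h u v = c := by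
  rw [mem_hexagonPoints] at hp
  rcases huv with rfl | rfl
  · have := hh.upper_right_side (k := (v + c).toNat) (by omega)
    rwa [show -(c : ℤ) + (v + c).toNat = v by omega] at this
  · have := hh.upper_left_side (k := (b - c - u).toNat) (by omega)
    rwa [show (b : ℤ) - c - (b - c - u).toNat = u by omega] at this

theorem vertical_step (hh : IsHeightFunction a b c V h) {u v : ℤ}
    (hp : (u, v) ∈ hexagonPoints a b c) (hp' : (u + 1, v + 1) ∈ hexagonPoints a b c) :
    h (u + 1) (v + 1) ≤ h u v ∧ h u v ≤ h (u + 1) (v + 1) + 1 := by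
  have hstep := hh.top_rule u v hp hp'
  have hindicator := indicator_one_mem_Icc V ⟨.top, (u + 1, v + 1)⟩
  exact ⟨by linarith [hindicator.2], by linarith [hindicator.1]⟩

theorem lower_bounds (hh : IsHeightFunction a b c V h) :
    ∀ u v, (u, v) ∈ hexagonPoints a b c → 0 ≤ h u v ∧ u + h u v ≤ b ∧ v + h u v ≤ a := by
  refine hexagonPoints_induction_up (fun u v hp hb => ?_) fun u v hp hp' ih => ?_
  · rw [hh.bottom u v hp hb]
    rw [mem_hexagonPoints] at hp
    omega
  · have := hh.vertical_step hp hp'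
    omega

theorem upper_bounds (hh : IsHeightFunction a b c V h) :
    ∀ u v, (u, v) ∈ hexagonPoints a b c → h u v ≤ c ∧ 0 ≤ u + h u v ∧ 0 ≤ v + h u v := by
  refine hexagonPoints_induction_down (fun u v hp hb => ?_) fun u v hp hp' ih => ?_
  · rw [hh.upper_side hp hb]
    rw [mem_hexagonPoints] at hp
    omega
  · have := hh.vertical_step hp hp'
    omega

theorem unique (hh : IsHeightFunction a b c V h) (hh' : IsHeightFunction a b c V h') :
    ∀ u v, (u, v) ∈ hexagonPoints a b c → h u v = h' u v := by
  refine hexagonPoints_induction_up (fun u v hp hb => ?_) fun u v hp hp' ih => ?_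
  · rw [hh.bottom u v hp hb, hh'.bottom u v hp hb]
  · linarith [hh.top_rule u v hp hp', hh'.top_rule u v hp hp']

theorem subset_of_eq (hh : IsHeightFunction a b c V h) (hh' : IsHeightFunction a b c V' h')
    (heq : ∀ u v, (u, v) ∈ hexagonPoints a b c → h u v = h' u v) : V ⊆ V' := by
  rintro ⟨k, u, v⟩ hL
  refine (Set.indicator_eq_one_iff_mem ℤ).1 (Eq.trans ?_ (Set.indicator_of_mem hL 1))
  cases k
  · obtain ⟨hp, hp', -⟩ := left_subset_hexagon.1 (hh.subset _ hL)
    rw [← hh'.left_rule u v hp hp', ← hh.left_rule u v hp hp', heq _ _ hp, heq _ _ hp']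
  · obtain ⟨hp, -, -, hp'⟩ := top_subset_hexagon.1 (hh.subset _ hL)
    have hstep := hh.top_rule (u - 1) (v - 1) hp (by simpa using hp')
    have hstep' := hh'.top_rule (u - 1) (v - 1) hp (by simpa using hp')
    rw [sub_add_cancel, sub_add_cancel] at hstep hstep'
    linarith [heq _ _ hp, heq _ _ hp']
  · obtain ⟨hp, hp', -⟩ := right_subset_hexagon.1 (hh.subset _ hL)
    rw [← hh'.right_rule u v hp hp', ← hh.right_rule u v hp hp', heq _ _ hp, heq _ _ hp']

theorem le_of_diagonals (hh : IsHeightFunction a b c V h) (hh' : IsHeightFunction a b c V' h')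
    (H : ∀ i j k : ℕ, i < b → j < a → k ≤ c →
      (k : ℤ) ≤ h (i + 1 - k) (j + 1 - k) → (k : ℤ) ≤ h' (i + 1 - k) (j + 1 - k))
    (u v : ℤ) (hp : (u, v) ∈ hexagonPoints a b c) : h u v ≤ h' u v := by
  obtain ⟨h0, hub, hva⟩ := hh.lower_bounds u v hp
  have hc := (hh.upper_bounds u v hp).1
  have h0' := hh'.upper_bounds u v hp
  by_cases hpos : 1 ≤ u + h u v ∧ 1 ≤ v + h u v
  · obtain ⟨k, hk⟩ := Int.eq_ofNat_of_zero_le h0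
    obtain ⟨i, hi⟩ := Int.eq_ofNat_of_zero_le (sub_nonneg.2 hpos.1)
    obtain ⟨j, hj⟩ := Int.eq_ofNat_of_zero_le (sub_nonneg.2 hpos.2)
    have hle := H i j k (by omega) (by omega) (by omega)
    rw [show (i : ℤ) + 1 - k = u by omega, show (j : ℤ) + 1 - k = v by omega] at hle
    exact hk.trans_le (hle hk.ge)
  · omega

theorem eq_of_diagonals (hh : IsHeightFunction a b c V h) (hh' : IsHeightFunction a b c V' h')
    (H : ∀ i j k : ℕ, i < b → j < a → k ≤ c →
      ((k : ℤ) ≤ h (i + 1 - k) (j + 1 - k) ↔ (k : ℤ) ≤ h' (i + 1 - k) (j + 1 - k))) : V = V' := by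
  have heq (u v : ℤ) (hp : (u, v) ∈ hexagonPoints a b c) : h u v = h' u v :=
    le_antisymm (hh.le_of_diagonals hh' (fun i j k hi hj hk => (H i j k hi hj hk).1) u v hp)
      (hh'.le_of_diagonals hh (fun i j k hi hj hk => (H i j k hi hj hk).2) u v hp)
  exact (hh.subset_of_eq hh' heq).antisymm
    (hh'.subset_of_eq hh fun u v hp => (heq u v hp).symm)

theorem le_diagonal_of_le (hh : IsHeightFunction a b c V h) {i j k l : ℕ} (hi : i < b)
    (hj : j < a) (hkl : k ≤ l) (hl : l ≤ c) (hle : (l : ℤ) ≤ h (i + 1 - l) (j + 1 - l)) :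
    (k : ℤ) ≤ h (i + 1 - k) (j + 1 - k) := by
  induction l, hkl using Nat.le_induction with
  | base => exact hle
  | succ l _ ih =>
    refine ih (by omega) ?_
    have hstep := hh.vertical_step (u := i + 1 - (l + 1 : ℕ)) (v := j + 1 - (l + 1 : ℕ))
      (by rw [mem_hexagonPoints]; omega) (by rw [mem_hexagonPoints]; omega)
    rw [show (i : ℤ) + 1 - (l + 1 : ℕ) + 1 = i + 1 - l by push_cast; ring,
      show (j : ℤ) + 1 - (l + 1 : ℕ) + 1 = j + 1 - l by push_cast; ring] at hstep
    omega

open Classical in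
/-- The number of cubes over a unit square of the floor, recovered from a height function. -/
noncomputable def column (a b c : ℕ) (h : ℤ → ℤ → ℤ) (i j : ℕ) : ℕ :=
  if i < b ∧ j < a then Nat.findGreatest (fun k => (k : ℤ) ≤ h (i + 1 - k) (j + 1 - k)) c else 0

theorem column_le (i j : ℕ) : column a b c h i j ≤ c := by
  rw [column]
  split_ifs
  · exact Nat.findGreatest_le _
  · exact Nat.zero_le _

theorem le_column_iff (hh : IsHeightFunction a b c V h) {i j k : ℕ} (hi : i < b) (hj : j < a)
    (hk : k ≤ c) : k ≤ column a b c h i j ↔ (k : ℤ) ≤ h (i + 1 - k) (j + 1 - k) := by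
  classical
  rw [column, if_pos ⟨hi, hj⟩]
  refine ⟨fun hle => hh.le_diagonal_of_le hi hj hle (Nat.findGreatest_le c) ?_,
    Nat.le_findGreatest (P := fun k : ℕ => (k : ℤ) ≤ h (i + 1 - k) (j + 1 - k)) hk⟩
  exact Nat.findGreatest_spec (P := fun k : ℕ => (k : ℤ) ≤ h (i + 1 - k) (j + 1 - k))
    (Nat.zero_le c) (hh.lower_bounds _ _ (by rw [mem_hexagonPoints]; push_cast; omega)).1

theorem column_row_anti (hh : IsHeightFunction a b c V h) (i j : ℕ) :
    column a b c h i (j + 1) ≤ column a b c h i j := by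
  by_cases hij : i < b ∧ j + 1 < a
  · have hle := (hh.le_column_iff hij.1 hij.2 (column_le i (j + 1))).1 le_rfl
    rw [hh.le_column_iff hij.1 (by omega) (column_le i (j + 1))]
    have hk := column_le (h := h) (a := a) (b := b) (c := c) i (j + 1)
    set k := column a b c h i (j + 1)
    have hstep := hh.right_rule (i + 1 - k) (j + 1 - k) (by rw [mem_hexagonPoints]; omega)
      (by rw [mem_hexagonPoints]; omega)
    rw [show (j : ℤ) + 1 - k + 1 = (j + 1 : ℕ) + 1 - k by push_cast; ring] at hstep
    linarith [(indicator_one_mem_Icc V ⟨.right, ((i : ℤ) + 1 - k, (j : ℤ) + 1 - k)⟩).1]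
  · rw [column, if_neg hij]
    exact Nat.zero_le _

theorem column_col_anti (hh : IsHeightFunction a b c V h) (i j : ℕ) :
    column a b c h (i + 1) j ≤ column a b c h i j := by
  by_cases hij : i + 1 < b ∧ j < a
  · have hle := (hh.le_column_iff hij.1 hij.2 (column_le (i + 1) j)).1 le_rfl
    rw [hh.le_column_iff (by omega) hij.2 (column_le (i + 1) j)]
    have hk := column_le (h := h) (a := a) (b := b) (c := c) (i + 1) j
    set k := column a b c h (i + 1) j
    have hstep := hh.left_rule (i + 1 - k) (j + 1 - k) (by rw [mem_hexagonPoints]; omega)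
      (by rw [mem_hexagonPoints]; omega)
    rw [show (i : ℤ) + 1 - k + 1 = (i + 1 : ℕ) + 1 - k by push_cast; ring] at hstep
    linarith [(indicator_one_mem_Icc V ⟨.left, ((i : ℤ) + 1 - k, (j : ℤ) + 1 - k)⟩).1]
  · rw [column, if_neg hij]
    exact Nat.zero_le _

/-- The pile of cubes seen in a tiling, recovered from a height function of the tiling. -/
noncomputable def planePartition (hh : IsHeightFunction a b c V h) :
    BoxedPlanePartition a b c where
  entry := column a b c h
  row_anti := hh.column_row_anti
  col_anti := hh.column_col_anti
  entry_le := column_le 0 0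
  rows_le _ _ hi := if_neg fun hij => hij.1.not_ge hi
  cols_le _ _ hj := if_neg fun hij => hij.2.not_ge hj

end IsHeightFunction

/-! ### Plane partitions and tilings -/

namespace BoxedPlanePartition

variable {a b c : ℕ}

/-- The point `(x, y, z)` belongs to the pile of cubes or to the walls behind it. -/
def Solid (π : BoxedPlanePartition a b c) (x y z : ℤ) : Prop :=
  z ≤ c ∧ (x ≤ 0 ∨ y ≤ 0 ∨ z ≤ π.entry (x - 1).toNat (y - 1).toNat)

theorem Solid.anti {π : BoxedPlanePartition a b c} {x y z x' y' z' : ℤ} (h : π.Solid x y z)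
    (hx : x' ≤ x) (hy : y' ≤ y) (hz : z' ≤ z) : π.Solid x' y' z' := by
  obtain ⟨hzc, h⟩ := h
  have := π.entry_anti (show (x' - 1).toNat ≤ (x - 1).toNat by omega)
    (show (y' - 1).toNat ≤ (y - 1).toNat by omega)
  exact ⟨by omega, by omega⟩

theorem solid_zero (π : BoxedPlanePartition a b c) (x y : ℤ) : π.Solid x y 0 :=
  ⟨by omega, by omega⟩

theorem solid_succ_iff {π : BoxedPlanePartition a b c} {i j : ℕ} {z : ℤ} :
    π.Solid (i + 1) (j + 1) z ↔ z ≤ π.entry i j := by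
  have := π.entry_le_height i j
  rw [Solid, show ((i : ℤ) + 1 - 1).toNat = i by omega, show ((j : ℤ) + 1 - 1).toNat = j by omega]
  omega

theorem le_height_iff {π : BoxedPlanePartition a b c} {i j k : ℕ} :
    k ≤ π.height i j ↔ π.Solid i j k := by
  rcases i with _ | i
  · simp [height, Solid]
  rcases j with _ | j
  · simp [height, Solid]
  · push_cast
    rw [solid_succ_iff, Nat.cast_le, height]

open Classical in
/-- The `z`-coordinate of the surface of the pile over a lattice point of the plane. -/
noncomputable def surface (π : BoxedPlanePartition a b c) (u v : ℤ) : ℤ :=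
  (Nat.findGreatest (fun k => π.Solid (u + k) (v + k) k) c : ℕ)

theorem surface_nonneg (π : BoxedPlanePartition a b c) (u v : ℤ) : 0 ≤ π.surface u v :=
  Int.natCast_nonneg _

theorem solid_surface (π : BoxedPlanePartition a b c) (u v : ℤ) :
    π.Solid (u + π.surface u v) (v + π.surface u v) (π.surface u v) := by
  classical
  exact Nat.findGreatest_spec (P := fun k : ℕ => π.Solid (u + k) (v + k) k) (Nat.zero_le c)
    (π.solid_zero _ _)

theorem le_surface_iff {π : BoxedPlanePartition a b c} {u v x y z : ℤ} (hz : 0 ≤ z)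
    (hx : u + z = x) (hy : v + z = y) : z ≤ π.surface u v ↔ π.Solid x y z := by
  classical
  subst hx hy
  refine ⟨fun h => (π.solid_surface u v).anti (by omega) (by omega) h, fun h => ?_⟩
  obtain ⟨k, rfl⟩ := Int.eq_ofNat_of_zero_le hz
  exact Int.ofNat_le.2 (Nat.le_findGreatest (P := fun k : ℕ => π.Solid (u + k) (v + k) k)
    (Int.ofNat_le.1 h.1) h)

theorem surface_lt_iff {π : BoxedPlanePartition a b c} {u v x y z : ℤ} (hz : 0 ≤ z)
    (hx : u + z = x) (hy : v + z = y) : π.surface u v < z ↔ ¬ π.Solid x y z := by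
  rw [← le_surface_iff hz hx hy, not_le]

theorem surface_anti (π : BoxedPlanePartition a b c) {u v u' v' : ℤ} (hu : u ≤ u') (hv : v ≤ v') :
    π.surface u' v' ≤ π.surface u v :=
  (le_surface_iff (π.surface_nonneg _ _) rfl rfl).2
    ((π.solid_surface u' v').anti (by omega) (by omega) le_rfl)

theorem surface_le_surface_add_one (π : BoxedPlanePartition a b c) {u v u' v' : ℤ}
    (hu : u' ≤ u + 1) (hv : v' ≤ v + 1) : π.surface u v ≤ π.surface u' v' + 1 := by
  by_cases hpos : 1 ≤ π.surface u v
  · exact sub_le_iff_le_add.1 ((le_surface_iff (sub_nonneg.2 hpos) rfl rfl).2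
      ((π.solid_surface u v).anti (by omega) (by omega) (by omega)))
  · linarith [π.surface_nonneg u' v']

theorem surface_bounds (π : BoxedPlanePartition a b c) {u v : ℤ}
    (hp : (u, v) ∈ hexagonPoints a b c) :
    0 ≤ u + π.surface u v ∧ 0 ≤ v + π.surface u v ∧ u + π.surface u v ≤ b ∧
      v + π.surface u v ≤ a := by
  rw [mem_hexagonPoints] at hp
  have hnonneg := π.surface_nonneg u v
  have hu (h : 0 ≤ -u) : -u ≤ π.surface u v := (le_surface_iff h rfl rfl).2 ⟨by omega, by omega⟩
  have hv (h : 0 ≤ -v) : -v ≤ π.surface u v := (le_surface_iff h rfl rfl).2 ⟨by omega, by omega⟩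
  have hsolid := (π.solid_surface u v).2
  have hrows := π.rows_le (u + π.surface u v - 1).toNat (v + π.surface u v - 1).toNat
  have hcols := π.cols_le (u + π.surface u v - 1).toNat (v + π.surface u v - 1).toNat
  omega

theorem isVisible_top_iff {π : BoxedPlanePartition a b c} {u v : ℤ}
    (hp : (u, v) ∈ hexagonPoints a b c) (hp' : (u - 1, v - 1) ∈ hexagonPoints a b c) :
    π.IsVisible ⟨.top, (u, v)⟩ ↔ π.surface (u - 1) (v - 1) ≤ π.surface u v := by
  constructor
  · rintro (⟨i, j, hi, hj⟩ | _ | _)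
    have hle := (le_surface_iff (π := π) (by omega) (sub_add_cancel _ _) (sub_add_cancel _ _)).2
      (solid_succ_iff.2 (le_refl (π.entry i j : ℤ)))
    have hlt := (surface_lt_iff (π := π) (u := i + 1 - π.entry i j - 1)
      (v := j + 1 - π.entry i j - 1) (by omega) (by ring) (by ring)).2
      (solid_succ_iff.not.2 (not_le.2 (lt_add_one (π.entry i j : ℤ))))
    exact (Int.le_of_lt_add_one hlt).trans hle
  · intro hle
    have hnonneg := π.surface_nonneg u v
    have hbounds := π.surface_bounds hp
    have hsolid := π.solid_surface u v
    have hempty : ¬ π.Solid (u + π.surface u v) (v + π.surface u v) (π.surface u v + 1) :=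
      (surface_lt_iff (by omega) (by ring) (by ring)).1 (Int.lt_add_one_of_le hle)
    rw [mem_hexagonPoints] at hp'
    have hpos : 1 ≤ u + π.surface u v ∧ 1 ≤ v + π.surface u v := by
      by_contra hneg
      exact hempty ⟨by omega, by omega⟩
    obtain ⟨i, hi⟩ := Int.eq_ofNat_of_zero_le (sub_nonneg.2 hpos.1)
    obtain ⟨j, hj⟩ := Int.eq_ofNat_of_zero_le (sub_nonneg.2 hpos.2)
    rw [sub_eq_iff_eq_add] at hi hj
    rw [hi, hj, solid_succ_iff] at hsolid hempty
    obtain rfl : u = i + 1 - π.entry i j := by omega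
    obtain rfl : v = j + 1 - π.entry i j := by omega
    exact .top i j (by omega) (by omega)

theorem isVisible_left_iff {π : BoxedPlanePartition a b c} {u v : ℤ}
    (hp : (u, v) ∈ hexagonPoints a b c) :
    π.IsVisible ⟨.left, (u, v)⟩ ↔ π.surface (u + 1) v < π.surface u v := by
  constructor
  · rintro (_ | ⟨i, j, k, hi, hj, hk, hk'⟩ | _)
    rw [← not_le, le_height_iff] at hk
    rw [le_height_iff] at hk'
    exact ((surface_lt_iff (by omega) (by push_cast; ring) (by push_cast; ring)).2 hk).trans_le
      ((le_surface_iff (by omega) (by ring) (by push_cast; ring)).2 hk')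
  · intro hlt
    have hbounds := π.surface_bounds hp
    have hsolid := π.solid_surface u v
    have hempty := (surface_lt_iff (π.surface_nonneg u v) rfl rfl).1 hlt
    have hpos : 1 ≤ v + π.surface u v := by
      by_contra hneg
      exact hempty ⟨hsolid.1, by omega⟩
    obtain ⟨k, hk⟩ := Int.eq_ofNat_of_zero_le (π.surface_nonneg u v)
    obtain ⟨i, hi⟩ := Int.eq_ofNat_of_zero_le hbounds.1
    obtain ⟨j, hj⟩ := Int.eq_ofNat_of_zero_le (sub_nonneg.2 hpos)
    obtain rfl : u = i - k := by omega
    obtain rfl : v = (j + 1 : ℕ) - k := by push_cast; omega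
    rw [hk] at hsolid hempty
    rw [sub_add_cancel, sub_add_cancel, ← le_height_iff] at hsolid
    rw [show (i : ℤ) - k + 1 + k = (i + 1 : ℕ) by push_cast; ring, sub_add_cancel,
      ← le_height_iff, not_le] at hempty
    exact .left i j k (by omega) (by omega) hempty hsolid

theorem isVisible_right_iff {π : BoxedPlanePartition a b c} {u v : ℤ}
    (hp : (u, v) ∈ hexagonPoints a b c) :
    π.IsVisible ⟨.right, (u, v)⟩ ↔ π.surface u (v + 1) < π.surface u v := by
  constructor
  · rintro (_ | _ | ⟨i, j, k, hi, hj, hk, hk'⟩)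
    rw [← not_le, le_height_iff] at hk
    rw [le_height_iff] at hk'
    exact ((surface_lt_iff (by omega) (by push_cast; ring) (by push_cast; ring)).2 hk).trans_le
      ((le_surface_iff (by omega) (by push_cast; ring) (by ring)).2 hk')
  · intro hlt
    have hbounds := π.surface_bounds hp
    have hsolid := π.solid_surface u v
    have hempty := (surface_lt_iff (π.surface_nonneg u v) rfl rfl).1 hlt
    have hpos : 1 ≤ u + π.surface u v := by
      by_contra hneg
      exact hempty ⟨hsolid.1, by omega⟩
    obtain ⟨k, hk⟩ := Int.eq_ofNat_of_zero_le (π.surface_nonneg u v)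
    obtain ⟨i, hi⟩ := Int.eq_ofNat_of_zero_le (sub_nonneg.2 hpos)
    obtain ⟨j, hj⟩ := Int.eq_ofNat_of_zero_le hbounds.2.1
    obtain rfl : u = (i + 1 : ℕ) - k := by push_cast; omega
    obtain rfl : v = j - k := by omega
    rw [hk] at hsolid hempty
    rw [sub_add_cancel, sub_add_cancel, ← le_height_iff] at hsolid
    rw [show (j : ℤ) - k + 1 + k = (j + 1 : ℕ) by push_cast; ring, sub_add_cancel,
      ← le_height_iff, not_le] at hempty
    exact .right i j k (by omega) (by omega) hempty hsolid

theorem IsVisible.subset_hexagon {π : BoxedPlanePartition a b c} {L : Lozenge}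
    (hL : π.IsVisible L) : L.triangles ⊆ hexagon a b c := by
  rcases hL with ⟨i, j, hi, hj⟩ | ⟨i, j, k, hi, hj, hpos, hk⟩ | ⟨i, j, k, hi, hj, hpos, hk⟩
  · have := π.entry_le_height i j
    simp only [proj, top_subset_hexagon, mem_hexagonPoints]
    omega
  · have := (le_height_iff.1 hk).1
    have := Nat.zero_lt_of_lt hpos
    simp only [proj, left_subset_hexagon, mem_hexagonPoints]
    omega
  · have := (le_height_iff.1 hk).1
    have := Nat.zero_lt_of_lt hpos
    simp only [proj, right_subset_hexagon, mem_hexagonPoints]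
    omega

theorem isHeightFunction (π : BoxedPlanePartition a b c) :
    IsHeightFunction a b c {L | π.IsVisible L} π.surface where
  subset _ hL := hL.subset_hexagon
  bottom u v hp huv := by
    have hbounds := π.surface_bounds hp
    have hnonneg := π.surface_nonneg u v
    omega
  top_rule u v hp hp' := by
    have hle := π.surface_anti (lt_add_one u).le (lt_add_one v).le
    have hle' := π.surface_le_surface_add_one (le_refl (u + 1)) (le_refl (v + 1))
    have hvis := isVisible_top_iff (π := π) hp' (by simpa using hp)
    simp only [Set.indicator, Set.mem_ofPred_eq, hvis, add_sub_cancel_right, Pi.one_apply]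
    split_ifs <;> omega
  left_rule u v hp _ := by
    have hle := π.surface_anti (lt_add_one u).le (le_refl v)
    have hle' := π.surface_le_surface_add_one (le_refl (u + 1)) (lt_add_one v).le
    simp only [Set.indicator, Set.mem_ofPred_eq, isVisible_left_iff hp, Pi.one_apply]
    split_ifs <;> omega
  right_rule u v hp _ := by
    have hle := π.surface_anti (le_refl u) (lt_add_one v).le
    have hle' := π.surface_le_surface_add_one (lt_add_one u).le (le_refl (v + 1))
    simp only [Set.indicator, Set.mem_ofPred_eq, isVisible_right_iff hp, Pi.one_apply]
    split_ifs <;> omega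

theorem le_surface_diagonal_iff {π : BoxedPlanePartition a b c} {i j k : ℕ} :
    (k : ℤ) ≤ π.surface (i + 1 - k) (j + 1 - k) ↔ k ≤ π.entry i j := by
  rw [le_surface_iff (Int.natCast_nonneg k) (sub_add_cancel _ _) (sub_add_cancel _ _),
    solid_succ_iff, Nat.cast_le]

end BoxedPlanePartition

theorem IsHeightFunction.eq_isVisible {a b c : ℕ} {V : Set Lozenge} {h : ℤ → ℤ → ℤ}
    (hh : IsHeightFunction a b c V h) : V = {L | hh.planePartition.IsVisible L} :=
  hh.eq_of_diagonals hh.planePartition.isHeightFunction fun _ _ _ hi hj hk =>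
    (hh.le_column_iff hi hj hk).symm.trans
      (BoxedPlanePartition.le_surface_diagonal_iff (π := hh.planePartition)).symm

namespace BoxedPlanePartition

variable {a b c : ℕ}

theorem eq_of_isVisible_iff {π π' : BoxedPlanePartition a b c}
    (h : ∀ L, π.IsVisible L ↔ π'.IsVisible L) : π = π' := by
  have hV : {L | π.IsVisible L} = {L | π'.IsVisible L} := Set.ext h
  have hsurface := π.isHeightFunction.unique (hV ▸ π'.isHeightFunction)
  have hentry (i j k : ℕ) (hi : i < b) (hj : j < a) (hk : k ≤ c) :
      k ≤ π.entry i j ↔ k ≤ π'.entry i j := by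
    rw [← le_surface_diagonal_iff, ← le_surface_diagonal_iff,
      hsurface _ _ (by rw [mem_hexagonPoints]; omega)]
  exact ext_entry fun i j hi hj =>
    le_antisymm ((hentry i j _ hi hj (π.entry_le_height i j)).1 le_rfl)
      ((hentry i j _ hi hj (π'.entry_le_height i j)).2 le_rfl)

theorem finite_isVisible (π : BoxedPlanePartition a b c) : {L | π.IsVisible L}.Finite := by
  have hbox : (Set.Icc (-(c : ℤ)) b ×ˢ Set.Icc (-(c : ℤ)) a).Finite :=
    (Set.finite_Icc _ _).prod (Set.finite_Icc _ _)
  refine (((hbox.image (Lozenge.mk .left)).union (hbox.image (Lozenge.mk .top))).union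
    (hbox.image (Lozenge.mk .right))).subset ?_
  rintro ⟨k, q⟩ hL
  cases k
  · obtain ⟨h1, h2, h3, h4, -⟩ := (left_subset_hexagon.1 hL.subset_hexagon).1
    exact .inl (.inl ⟨q, ⟨⟨h1, h2⟩, ⟨h3, h4⟩⟩, rfl⟩)
  · obtain ⟨h1, h2, h3, h4, -⟩ := (top_subset_hexagon.1 hL.subset_hexagon).2.2.2
    exact .inl (.inr ⟨q, ⟨⟨h1, h2⟩, ⟨h3, h4⟩⟩, rfl⟩)
  · obtain ⟨h1, h2, h3, h4, -⟩ := (right_subset_hexagon.1 hL.subset_hexagon).1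
    exact .inr ⟨q, ⟨⟨h1, h2⟩, ⟨h3, h4⟩⟩, rfl⟩

/-- The lozenge tiling that is the picture of a plane partition. -/
noncomputable def tiling (π : BoxedPlanePartition a b c) : Finset Lozenge :=
  π.finite_isVisible.toFinset

theorem mem_tiling {π : BoxedPlanePartition a b c} {L : Lozenge} :
    L ∈ π.tiling ↔ π.IsVisible L := π.finite_isVisible.mem_toFinset

theorem coe_tiling (π : BoxedPlanePartition a b c) : (π.tiling : Set Lozenge) =
    {L | π.IsVisible L} := π.finite_isVisible.coe_toFinset

theorem tiling_injective : Function.Injective (tiling : BoxedPlanePartition a b c → _) :=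
  fun π π' h => eq_of_isVisible_iff fun L => by rw [← mem_tiling, h, mem_tiling]

theorem range_tiling : Set.range (tiling : BoxedPlanePartition a b c → _) =
    lozengeTilings a b c := by
  refine Set.Subset.antisymm ?_ fun T hT => ?_
  · rintro _ ⟨π, rfl⟩
    exact IsHeightFunction.mem_lozengeTilings (π.coe_tiling ▸ π.isHeightFunction)
  · refine ⟨(isHeightFunction_tilingHeight hT).planePartition, Finset.coe_injective ?_⟩
    rw [coe_tiling, ← IsHeightFunction.eq_isVisible]

theorem hasHeight_tiling {π : BoxedPlanePartition a b c} {q : ℤ × ℤ} {h : ℕ} :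
    HasHeight a b c π.tiling q h ↔ ∃ i j : ℕ, i < b ∧ j < a ∧
      q = proj (i + 1) (j + 1) (π.entry i j) ∧ π.entry i j = h := by
  constructor
  · rintro ⟨π', hT, hq⟩
    obtain rfl : π = π' := eq_of_isVisible_iff fun L => by rw [← mem_tiling, hT]
    exact hq
  · exact fun hq => ⟨π, fun _ => mem_tiling, hq⟩

theorem isLeftCorner_tiling {π : BoxedPlanePartition a b c} {i j : ℕ} (hi : i < b) (hj : j < a) :
    IsLeftCorner π.tiling (proj (i + 1) (j + 1) (π.entry i j)) ↔
      π.entry (i + 1) j < π.entry i j := by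
  have htop := IsVisible.top (π := π) i j hi hj
  rw [IsLeftCorner, mem_tiling, mem_tiling, and_iff_right htop]
  constructor
  · intro hleft
    have hdrop := (isVisible_left_iff
      (top_subset_hexagon.1 htop.subset_hexagon).2.2.2).1 hleft
    have hle : π.surface (i + 1 - π.entry i j) (j + 1 - π.entry i j) < π.entry i j + 1 :=
      (surface_lt_iff (x := (i + 1 : ℕ) + 1) (y := (j + 1 : ℕ) + 1) (by omega)
        (by push_cast; ring) (by push_cast; ring)).2
        (solid_succ_iff.not.2 (by
          have := π.entry_anti (i.le_add_right 1) (j.le_add_right 1)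
          omega))
    have hnot := (surface_lt_iff (π := π) (x := (i + 1 : ℕ) + 1) (y := j + 1) (Int.natCast_nonneg _)
      (by push_cast; ring) (by ring)).1 (hdrop.trans_le (Int.le_of_lt_add_one hle))
    rw [solid_succ_iff] at hnot
    omega
  · intro hlt
    have := IsVisible.left (π := π) (i + 1) j (π.entry i j) hi hj hlt le_rfl
    rwa [Nat.cast_succ] at this

theorem cornerCount_tiling (π : BoxedPlanePartition a b c) (ℓ : Fin c) :
    cornerCount a b c π.tiling ℓ = π.corners (ℓ + 1) := by
  rw [cornerCount, corners, ← Set.ncard_coe_finset]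
  symm
  refine Set.ncard_congr (fun p _ => proj (p.1 + 1) (p.2 + 1) (ℓ + 1)) ?_ ?_ ?_
  all_goals simp only [Finset.coe_filter, Finset.mem_univ, true_and, Set.mem_ofPred_eq]
  · rintro ⟨i, j⟩ ⟨hk, hlt⟩
    have hq : proj ((i : ℕ) + 1) ((j : ℕ) + 1) (ℓ + 1) =
        proj ((i : ℕ) + 1) ((j : ℕ) + 1) (π.entry i j) := by rw [hk, Nat.cast_succ]
    refine ⟨?_, hasHeight_tiling.2 ⟨i, j, i.2, j.2, hq, hk⟩⟩
    rw [hq, isLeftCorner_tiling i.2 j.2, hk]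
    exact hlt
  · intro p p' _ _ h
    simp only [proj, Prod.mk.injEq] at h
    ext <;> omega
  · rintro q ⟨hcorner, hheight⟩
    obtain ⟨i, j, hi, hj, rfl, hk⟩ := hasHeight_tiling.1 hheight
    rw [isLeftCorner_tiling hi hj, hk] at hcorner
    exact ⟨(⟨i, hi⟩, ⟨j, hj⟩), ⟨hk, hcorner⟩, by rw [hk, Nat.cast_succ]⟩

end BoxedPlanePartition

/-! ### The generating function of a random tiling -/

theorem uniformOn_range_real {ι Ω Γ : Type*} [Fintype ι] [MeasurableSpace Ω]
    [DiscreteMeasurableSpace Ω] [DecidableEq Γ] {f : ι → Ω} (hf : Function.Injective f)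
    (X : Ω → Γ) (γ : Γ) :
    (ProbabilityTheory.uniformOn (Set.range f)).real {ω | X ω = γ} =
      (Finset.univ.filter fun i => X (f i) = γ).card / Fintype.card ι := by
  classical
  have hrange : Set.range f = (Finset.univ.image f : Finset Ω) := by simp
  have hinter : Set.range f ∩ {ω | X ω = γ} =
      ((Finset.univ.filter fun i => X (f i) = γ).image f : Finset Ω) := by
    ext ω
    simp only [Set.mem_inter_iff, Set.mem_range, Set.mem_ofPred_eq, Finset.coe_image,
      Finset.coe_filter, Finset.mem_univ, true_and, Set.mem_image]
    aesop
  rw [MeasureTheory.measureReal_def, ProbabilityTheory.uniformOn,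
    ProbabilityTheory.cond_apply MeasurableSet.of_discrete, hinter, hrange,
    MeasureTheory.Measure.count_apply_finset, MeasureTheory.Measure.count_apply_finset,
    Finset.card_image_of_injective _ hf, Finset.card_image_of_injective _ hf]
  simp [div_eq_inv_mul]

theorem hasSum_uniformOn_range {ι Ω Γ : Type*} [Fintype ι] [MeasurableSpace Ω]
    [DiscreteMeasurableSpace Ω] {f : ι → Ω} (hf : Function.Injective f) (X : Ω → Γ)
    (w : Γ → ℂ) :
    HasSum (fun γ => ((ProbabilityTheory.uniformOn (Set.range f)).real {ω | X ω = γ} : ℂ) * w γ)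
      ((∑ i, w (X (f i))) / Fintype.card ι) := by
  classical
  have hfiber (i : ι) : HasSum (fun γ => if X (f i) = γ then w γ else 0) (w (X (f i))) := by
    simpa only [if_true] using hasSum_single (X (f i)) fun γ hγ => if_neg hγ.symm
  refine ((hasSum_sum fun i (_ : i ∈ Finset.univ) => hfiber i).div_const _).congr_fun fun γ => ?_
  rw [uniformOn_range_real hf, ← Finset.sum_filter, Finset.sum_const, nsmul_eq_mul]
  push_cast
  ring

theorem schur_rectangle_one {a b c : ℕ} (hb : 0 < b) :
    schur (rectangle a b) (fun _ : Fin (b + c) => 1) =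
      Fintype.card (BoxedPlanePartition a b c) := by
  have happend : (Fin.append (fun _ : Fin b => (1 : ℂ)) fun _ : Fin c => 1) = fun _ => 1 :=
    funext (Fin.addCases (by simp) (by simp))
  rw [← happend, ← BoxedPlanePartition.sum_prod_corners hb]
  simp

/-- The joint probability generating function of the numbers of left corners of heights
`1, …, c` in a uniformly random lozenge tiling of the hexagon. -/
theorem theorem5p1 (a b c : ℕ) (ha : 0 < a) (hb : 0 < b) (hc : 0 < c) (x : Fin c → ℂ) :
    HasSum
      (fun γ : Fin c → ℕ =>
        ((ProbabilityTheory.uniformOn (lozengeTilings a b c)).real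
            {T | cornerCount a b c T = γ} : ℂ) *
          ∏ ℓ, x ℓ ^ γ ℓ)
      (normalizedSchur (rectangle a b) x (b + c)) ∧
    normalizedSchur (rectangle a b) x (b + c) =
      schur (rectangle a b) (Fin.append (fun _ : Fin b => 1) x) /
        schur (rectangle a b) (fun _ : Fin (b + c) => 1) := by
  refine ⟨?_, normalizedSchur_rectangle x⟩
  have : DiscreteMeasurableSpace (Finset Lozenge) := ⟨fun _ => trivial⟩
  rw [normalizedSchur_rectangle, ← BoxedPlanePartition.sum_prod_corners hb,
    schur_rectangle_one hb, ← BoxedPlanePartition.range_tiling]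
  have h := hasSum_uniformOn_range (BoxedPlanePartition.tiling_injective (a := a) (b := b) (c := c))
    (cornerCount a b c) fun γ => ∏ ℓ, x ℓ ^ γ ℓ
  simpa only [BoxedPlanePartition.cornerCount_tiling] using h
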